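/- A finite simple graph $G$ with $n$ vertices and complement $\overline{G}$ is called an \emph{NG-graph} if $\chi(G)+\chi(\overline{G})=n+1$, where $\chi$ denotes the chromatic number. For an integer $k\ge 1$ put $A=\{v:\deg(v)=k-1\}$, $B=\{v:\deg(v)>k-1\}$, $C=\{v:\deg(v)<k-1\}$. Consider the conditions (i) $A\neq\emptyset$, and $G[A]$ is a complete graph, an independent set or a 5-cycle; (ii) $G[B]$ is complete; (iii) $G[C]$ is an independent set; (iv) $ab\in E(G)$ for all $a\in A$, $b\in B$; (v) $ac\notin E(G)$ for all $a\in A$, $c\in C$; (vi) $|A|+|B|=k$ (with $G[A]$ complete), or $|B|+1=k$ (with $G[A]$ independent), or $|B|+3=k$ (with $G[A]$ a 5-cycle). Algorithm NG takes the adjacency matrix of a graph $G$ with $n$ vertices as input. Starting with $k=1$, it computes the partition $A,B,C$ from the vertex degrees and tests (i)--(vi) for the current $k$. If all tests succeed, it stops with the answer "yes, $\chi(G)=k$". Otherwise it replaces $k$ by $k+1$ and repeats if $k<n$, and it stops with the answer "no" if $k\ge n$. It is written as a program of a random access machine with finitely many registers and an addressable memory, on which reading an entry of the adjacency matrix, copying,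 adding $1$, loading, storing and comparing take one step each. \textbf{Theorem.} Algorithm NG decides in polynomial time whether a graph is an NG-graph, and computes the chromatic number of NG-graphs. Precisely, there is a constant $c$ such that for every $n\ge 0$ and every graph $G$ with vertex set $\{0,\dots,n-1\}$, the algorithm halts on $G$ after at most $c\,(n^3+1)$ steps; if $G$ is an NG-graph, it answers "yes" and returns $k=\chi(G)$; if $G$ is not an NG-graph, it answers "no". Moreover, for each $k\in\{1,\dots,n\}$, conditions (i)--(vi) hold for $k$ if and only if the algorithm answers "yes" and returns this $k$. -/

import Mathlib

/-- A graph on `n` vertices is an NG-graph if `χ(G) + χ(Gᶜ) = n + 1`. -/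
def IsNGGraph {V : Type*} [Fintype V] (G : SimpleGraph V) : Prop :=
  G.chromaticNumber + Gᶜ.chromaticNumber = (Fintype.card V : ℕ∞) + 1

/-! ### The machine model

Programs of a successor random access machine: finitely many registers (named by the type `R`),
an unbounded memory addressed by natural numbers, and read access to the entries of the input
matrix.  Every elementary instruction and every evaluation of a condition takes one step.  The
only arithmetic instruction adds `1`, so no number in a run exceeds the numbers present at its
start (or in the program text) by more than the number of steps. -/

namespace RAM

/-- Instruction operands: a constant or the content of a register. -/
inductive Operand (R : Type) : Type
  | lit (c : ℕ)
  | reg (x : R)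

/-- Conditions: comparisons of two operands. -/
inductive Cond (R : Type) : Type
  | eq (a b : Operand R)
  | lt (a b : Operand R)

/-- Programs. -/
inductive Cmd (R : Type) : Type
  /-- do nothing -/
  | skip
  /-- `x := a` -/
  | set (x : R) (a : Operand R)
  /-- `x := x + 1` -/
  | inc (x : R)
  /-- `x := mem[a]` -/
  | load (x : R) (a : Operand R)
  /-- `mem[a] := b` -/
  | store (a b : Operand R)
  /-- `x := input[a, b]` -/
  | query (x : R) (a b : Operand R)
  /-- run `p`, then `q` -/
  | seq (p q : Cmd R)
  /-- if `c` then `p` else `q` -/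
  | ite (c : Cond R) (p q : Cmd R)
  /-- while `c` do `p` -/
  | loop (c : Cond R) (p : Cmd R)

/-- Registers and memory. -/
structure State (R : Type) : Type where
  reg : R → ℕ
  mem : ℕ → ℕ

variable {R : Type} [DecidableEq R]

/-- The value of an operand. -/
def Operand.val (s : State R) : Operand R → ℕ
  | .lit c => c
  | .reg x => s.reg x

/-- Truth of a condition. -/
def Cond.Holds (s : State R) : Cond R → Prop
  | .eq a b => a.val s = b.val s
  | .lt a b => a.val s < b.val s

/-- Change the content of the register `x` to `a`. -/
def State.setReg (s : State R) (x : R) (a : ℕ) : State R :=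
  { s with reg := Function.update s.reg x a }

/-- Change the content of the memory cell `i` to `a`. -/
def State.setMem (s : State R) (i a : ℕ) : State R :=
  { s with mem := Function.update s.mem i a }

/-- `Exec M p s t s'`: with input matrix `M`, the program `p` started in the state `s` halts
after exactly `t` steps in the state `s'`. -/
inductive Exec (M : ℕ → ℕ → ℕ) : Cmd R → State R → ℕ → State R → Prop
  | skip (s) : Exec M .skip s 1 s
  | set (s x a) : Exec M (.set x a) s 1 (s.setReg x (a.val s))
  | inc (s x) : Exec M (.inc x) s 1 (s.setReg x (s.reg x + 1))
  | load (s x a) : Exec M (.load x a) s 1 (s.setReg x (s.mem (a.val s)))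
  | store (s a b) : Exec M (.store a b) s 1 (s.setMem (a.val s) (b.val s))
  | query (s x a b) : Exec M (.query x a b) s 1 (s.setReg x (M (a.val s) (b.val s)))
  | seq {p q s s' s'' t t'} : Exec M p s t s' → Exec M q s' t' s'' →
      Exec M (.seq p q) s (t + t') s''
  | ite_true {c p q s s' t} : c.Holds s → Exec M p s t s' → Exec M (.ite c p q) s (t + 1) s'
  | ite_false {c p q s s' t} : ¬ c.Holds s → Exec M q s t s' → Exec M (.ite c p q) s (t + 1) s'
  | loop_true {c p s s' s'' t t'} : c.Holds s → Exec M p s t s' → Exec M (.loop c p) s' t' s'' →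
      Exec M (.loop c p) s (t + t' + 1) s''
  | loop_false {c p s} : ¬ c.Holds s → Exec M (.loop c p) s 1 s

/-- The final state and the number of steps are determined by the input. -/
theorem Exec.deterministic {M : ℕ → ℕ → ℕ} {p : Cmd R} {s s₁ s₂ : State R} {t₁ t₂ : ℕ}
    (h₁ : Exec M p s t₁ s₁) (h₂ : Exec M p s t₂ s₂) : t₁ = t₂ ∧ s₁ = s₂ := by
  induction h₁ generalizing t₂ s₂ with
  | skip | set | inc | load | store | query => cases h₂; exact ⟨rfl, rfl⟩
  | seq _ _ ih ih' =>
    cases h₂ with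
    | seq k k' =>
      obtain ⟨rfl, rfl⟩ := ih k
      obtain ⟨rfl, rfl⟩ := ih' k'
      exact ⟨rfl, rfl⟩
  | ite_true h _ ih =>
    cases h₂ with
    | ite_true _ k => obtain ⟨rfl, rfl⟩ := ih k; exact ⟨rfl, rfl⟩
    | ite_false h' _ => exact absurd h h'
  | ite_false h _ ih =>
    cases h₂ with
    | ite_true h' _ => exact absurd h' h
    | ite_false _ k => obtain ⟨rfl, rfl⟩ := ih k; exact ⟨rfl, rfl⟩
  | loop_true h _ _ ih ih' =>
    cases h₂ with
    | loop_true _ k k' =>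
      obtain ⟨rfl, rfl⟩ := ih k
      obtain ⟨rfl, rfl⟩ := ih' k'
      exact ⟨rfl, rfl⟩
    | loop_false h' => exact absurd h h'
  | loop_false h =>
    cases h₂ with
    | loop_true h' _ _ => exact absurd h' h
    | loop_false _ => exact ⟨rfl, rfl⟩

/-- Sequential composition of a list of programs. -/
def block : List (Cmd R) → Cmd R
  | [] => .skip
  | [p] => p
  | p :: q :: l => .seq p (block (q :: l))

end RAM

/-! ### Algorithm NG -/

namespace AlgorithmNG

open RAM

/-- The registers of the program. -/
inductive Var : Type
  /-- number of vertices (input) -/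
  | n
  /-- current candidate for the chromatic number (output, if the answer is yes) -/
  | k
  /-- answer: `1` for yes, `0` for no (output) -/
  | ans
  /-- `1` as long as the main loop has to be repeated -/
  | go
  /-- `1` as long as no question of the current round was answered by no -/
  | ok
  /-- is `G[A]` complete? -/
  | compl
  /-- is `G[A]` independent? -/
  | indep
  /-- is `G[A]` a 5-cycle? -/
  | cyc
  /-- result of a single test -/
  | r
  /-- vertices -/
  | u
  | v
  /-- classes of `u` and `v` -/
  | cu
  | cv
  /-- a matrix entry -/
  | e
  /-- counters -/
  | d
  | x
  deriving DecidableEq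

/-- `for y = 0, …, n - 1 do p` -/
def forVertices (y : Var) (p : Cmd Var) : Cmd Var :=
  block [.set y (.lit 0), .loop (.lt (.reg y) (.reg .n)) (block [p, .inc y])]

/-- if the content of `y` is `c` then `p` -/
def whenEq (y : Var) (c : ℕ) (p : Cmd Var) : Cmd Var :=
  .ite (.eq (.reg y) (.lit c)) p .skip

/-- Codes of the classes `A`, `B`, `C`; memory cell `v` holds the class of the vertex `v`. -/
abbrev clA : ℕ := 1
abbrev clB : ℕ := 2
abbrev clC : ℕ := 3

/-- Put every vertex `v` into `A`, `B` or `C`, according to whether `deg v` is equal to, greater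
than or less than `k - 1`; `d` becomes `deg v + 1`. -/
def partition : Cmd Var :=
  forVertices .v (block [
    .set .d (.lit 1),
    forVertices .u (block [.query .e (.reg .v) (.reg .u), whenEq .e 1 (.inc .d)]),
    .ite (.eq (.reg .d) (.reg .k)) (.store (.reg .v) (.lit clA))
      (.ite (.lt (.reg .k) (.reg .d)) (.store (.reg .v) (.lit clB))
        (.store (.reg .v) (.lit clC)))])

/-- Set `y` to `0` if there are distinct vertices `u` of class `c` and `v` of class `c'` whose
entry in the adjacency matrix is `bad`, and to `1` otherwise. -/
def testPairs (c c' bad : ℕ) (y : Var) : Cmd Var :=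
  block [.set y (.lit 1),
    forVertices .u (forVertices .v (block [
      .load .cu (.reg .u),
      .load .cv (.reg .v),
      whenEq .cu c (whenEq .cv c' (.ite (.eq (.reg .u) (.reg .v)) .skip
        (block [.query .e (.reg .u) (.reg .v), whenEq .e bad (.set y (.lit 0))])))]))]

/-- Increase `x` by the number of vertices of class `c`. -/
def addCard (c : ℕ) : Cmd Var :=
  forVertices .u (block [.load .cu (.reg .u), whenEq .cu c (.inc .x)])

/-- Set `cyc` to `1` if `G[A]` is a 5-cycle, that is, `A` has five vertices each of which has
exactly two neighbours in `A`, and to `0` otherwise. -/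
def testFiveCycle : Cmd Var :=
  block [.set .cyc (.lit 1),
    .set .x (.lit 0), addCard clA,
    .ite (.eq (.reg .x) (.lit 5)) .skip (.set .cyc (.lit 0)),
    forVertices .u (block [.load .cu (.reg .u),
      whenEq .cu clA (block [.set .d (.lit 0),
        forVertices .v (block [.load .cv (.reg .v),
          whenEq .cv clA (block [.query .e (.reg .u) (.reg .v), whenEq .e 1 (.inc .d)])]),
        .ite (.eq (.reg .d) (.lit 2)) .skip (.set .cyc (.lit 0))])])]

/-- Question (i): is `A` nonempty and `G[A]` a complete graph, an independent set or a 5-cycle? -/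
def questionI : Cmd Var :=
  block [.set .ok (.lit 0),
    testPairs clA clA 0 .compl, whenEq .compl 1 (.set .ok (.lit 1)),
    testPairs clA clA 1 .indep, whenEq .indep 1 (.set .ok (.lit 1)),
    testFiveCycle, whenEq .cyc 1 (.set .ok (.lit 1)),
    .set .x (.lit 0), addCard clA, whenEq .x 0 (.set .ok (.lit 0))]

/-- If all answers so far were yes, ask whether no two distinct vertices of classes `c` and `c'`
have the entry `bad` in the adjacency matrix. -/
def question (c c' bad : ℕ) : Cmd Var :=
  whenEq .ok 1 (block [testPairs c c' bad .r, whenEq .r 0 (.set .ok (.lit 0))])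

/-- Step (vi): compare `k` with `|A| + |B|`, `|B| + 1` or `|B| + 3`, according to the form of
`G[A]`. -/
def stepVI : Cmd Var :=
  block [
    whenEq .compl 1 (block [.set .x (.lit 0), addCard clA, addCard clB,
      .ite (.eq (.reg .x) (.reg .k)) (.set .ans (.lit 1)) .skip]),
    whenEq .indep 1 (block [.set .x (.lit 1), addCard clB,
      .ite (.eq (.reg .x) (.reg .k)) (.set .ans (.lit 1)) .skip]),
    whenEq .cyc 1 (block [.set .x (.lit 3), addCard clB,
      .ite (.eq (.reg .x) (.reg .k)) (.set .ans (.lit 1)) .skip])]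

/-- One round of the main loop, for the current value of `k`. -/
def round : Cmd Var :=
  block [
    partition,
    questionI,
    -- (ii) is `G[B]` complete?
    question clB clB 0,
    -- (iii) is `G[C]` independent?
    question clC clC 1,
    -- (iv) are all pairs from `A × B` adjacent?
    question clA clB 0,
    -- (v) are all pairs from `A × C` nonadjacent?
    question clA clC 1,
    whenEq .ok 1 stepVI,
    .ite (.eq (.reg .ans) (.lit 1)) (.set .go (.lit 0))
      (.ite (.lt (.reg .k) (.reg .n)) (.inc .k) (.set .go (.lit 0)))]

/-- Algorithm NG. -/
def program : Cmd Var :=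
  block [.set .k (.lit 1), .set .ans (.lit 0), .set .go (.lit 1),
    .loop (.eq (.reg .go) (.lit 1)) round]

/-- The adjacency matrix of a graph with the vertices `0, …, n - 1`, as the input matrix. -/
def inputMatrix {n : ℕ} (G : SimpleGraph (Fin n)) [DecidableRel G.Adj] (i j : ℕ) : ℕ :=
  if h : i < n ∧ j < n then (if G.Adj ⟨i, h.1⟩ ⟨j, h.2⟩ then 1 else 0) else 0

/-- The initial state: `n` is the number of vertices, everything else is `0`. -/
def initState (n : ℕ) : State Var where
  reg y := if y = .n then n else 0
  mem _ := 0

end AlgorithmNG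

/-! ### The degree conditions -/

section Conditions

variable {V : Type*} [Fintype V] (G : SimpleGraph V) [DecidableRel G.Adj] (k : ℕ)

/-- The vertices of degree `k - 1`. -/
def classA : Set V := {v | G.degree v + 1 = k}

/-- The vertices of degree greater than `k - 1`. -/
def classB : Set V := {v | k < G.degree v + 1}

/-- The vertices of degree less than `k - 1`. -/
def classC : Set V := {v | G.degree v + 1 < k}

/-- Questions (i)-(v) and check (vi) for the candidate `k`. -/
structure ABCConditions : Prop where
  nonempty : (classA G k).Nonempty
  form : (G.IsClique (classA G k) ∧ (classA G k).ncard + (classB G k).ncard = k) ∨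
    (G.IsIndepSet (classA G k) ∧ (classB G k).ncard + 1 = k) ∨
    (Nonempty (G.induce (classA G k) ≃g SimpleGraph.cycleGraph 5) ∧ (classB G k).ncard + 3 = k)
  cliqueB : G.IsClique (classB G k)
  indepC : G.IsIndepSet (classC G k)
  adjAB : ∀ a ∈ classA G k, ∀ b ∈ classB G k, G.Adj a b
  nonadjAC : ∀ a ∈ classA G k, ∀ c ∈ classC G k, ¬ G.Adj a c

end Conditions

/-! ### Colourings of finite vertex sets -/

/-! Everything is phrased through sharpness of the Nordhaus-Gaddum inequality: if `G` is not
`a`-colourable and `Gᶜ` is not `b`-colourable, then `a + b < n`. So `G` is an NG-graph exactly if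
such `a`, `b` exist with `a + b + 1 = n` (`isNGGraph_iff`), and then `χ(G) = a + 1`.

From sharpness to the conditions, with `k = a + 1`: deleting two nonadjacent vertices, one of degree
at least `a` and one of degree greater than `a`, would leave a graph violating the inequality
(`adj_of_le_degree`). Hence `B` is a clique joined to all of `A`; the same argument in the
complement makes `C` independent without edges to `A`. Thus `G[A]` is regular, of degree `d = a -
|B|`. Vertices of degree less than `a` never obstruct an `a`-colouring, so `G[A]` is not
`d`-colourable, and dually its complement is not `(|A| - 1 - d)`-colourable.

It remains to classify such regular graphs. After passing to the complement if necessary, `2 * d + 1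
≤ m`, where `m` is the number of vertices. A matching of `G` with `f` uncovered vertices colours
`Gᶜ` with `(m + f) / 2` colours, so a maximum matching leaves many vertices uncovered, while
counting edges at these vertices bounds `f` from above. Equality in the count, together with
rotations along alternating paths, forces `d = 2` and `m = 5` unless `d = 0`
(`eq_two_of_not_colorable_compl`).

Conversely, the conditions for `k` yield a clique of size `k`, or a clique `B` completely joined to
a 5-cycle, so `χ(G) ≥ k`. They are self-dual under complementation with `k` replaced by `n + 1 - k`,
so `χ(Gᶜ) ≥ n + 1 - k` as well, and the inequality is sharp. In particular `k = χ(G)` is unique, so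
the first candidate accepted by the algorithm is the only one.

For the program, Hoare-style rules carry a step bound and the effect of each command together. One
round takes quadratic time, and there are at most `max n 1` rounds. -/

namespace SimpleGraph

open Finset

/-- The vertices in `S` can be coloured properly with the colours `0, …, a - 1`. -/
def ColorableOn {V : Type*} (G : SimpleGraph V) (S : Finset V) (a : ℕ) : Prop :=
  ∃ f : V → ℕ, (∀ v ∈ S, f v < a) ∧ ∀ u ∈ S, ∀ v ∈ S, G.Adj u v → f u ≠ f v

section ColorableOn

variable {V : Type*} {G H : SimpleGraph V} {S T : Finset V} {a b : ℕ}

theorem colorableOn_univ [Fintype V] : G.ColorableOn univ a ↔ G.Colorable a := by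
  constructor
  · rintro ⟨f, hf, hG⟩
    exact ⟨Coloring.mk (fun v => (⟨f v, hf v (mem_univ v)⟩ : Fin a)) fun {u v} h e =>
      hG u (mem_univ u) v (mem_univ v) h (congrArg Fin.val e)⟩
  · rintro ⟨C⟩
    exact ⟨fun v => C v, fun v _ => (C v).2, fun u _ v _ h e => C.valid h (Fin.ext e)⟩

theorem colorableOn_induce {s : Set V} [Fintype s] (hs : ∀ v, v ∈ S ↔ v ∈ s)
    (h : (G.induce s).Colorable a) : G.ColorableOn S a := by
  classical
  obtain ⟨C⟩ := h
  refine ⟨fun v => if hv : v ∈ s then C ⟨v, hv⟩ else 0, fun v hv => ?_, fun u hu v hv huv => ?_⟩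
  · simp [(hs v).1 hv]
  · simp only [(hs v).1 hv, (hs u).1 hu, dite_true]
    exact fun e => C.valid (v := ⟨u, (hs u).1 hu⟩) (w := ⟨v, (hs v).1 hv⟩) huv (Fin.ext e)

theorem ColorableOn.mono_left (h : G.ColorableOn T a) (hST : S ⊆ T) : G.ColorableOn S a := by
  obtain ⟨f, hf, hG⟩ := h
  exact ⟨f, fun v hv => hf v (hST hv), fun u hu v hv => hG u (hST hu) v (hST hv)⟩

theorem ColorableOn.mono (h : G.ColorableOn S a) (hab : a ≤ b) : G.ColorableOn S b := by
  obtain ⟨f, hf, hG⟩ := h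
  exact ⟨f, fun v hv => (hf v hv).trans_le hab, hG⟩

theorem colorableOn_one (h : ∀ u ∈ S, ∀ v ∈ S, ¬ G.Adj u v) : G.ColorableOn S 1 :=
  ⟨fun _ => 0, fun _ _ => one_pos, fun u hu v hv huv => absurd huv (h u hu v hv)⟩

variable [DecidableEq V]

theorem ColorableOn.union (h : G.ColorableOn S a) (h' : G.ColorableOn T b) :
    G.ColorableOn (S ∪ T) (a + b) := by
  obtain ⟨f, hf, hG⟩ := h
  obtain ⟨g, hg, hG'⟩ := h'
  refine ⟨fun v => if v ∈ S then f v else a + g v, fun v hv => ?_, fun u hu v hv huv => ?_⟩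
  · rcases em (v ∈ S) with h | h
    · have := hf v h
      simp only [h, if_true]; omega
    · have := hg v ((mem_union.1 hv).resolve_left h)
      simp only [h, if_false]; omega
  · rcases em (u ∈ S) with h | h <;> rcases em (v ∈ S) with k | k <;>
      simp only [h, k, if_true, if_false]
    · exact hG u h v k huv
    · have := hf u h; omega
    · have := hf v k; omega
    · have := hG' u ((mem_union.1 hu).resolve_left h) v ((mem_union.1 hv).resolve_left k) huv
      omega

/-- Greedy step: the neighbours of `v` in `S` use fewer than `a` colours, so one is free. -/
theorem ColorableOn.insert_of_card_lt [DecidableRel G.Adj] (h : G.ColorableOn S a) {v : V}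
    (hv : v ∉ S) (hd : #{u ∈ S | G.Adj v u} < a) : G.ColorableOn (insert v S) a := by
  obtain ⟨f, hf, hG⟩ := h
  obtain ⟨c, hc, hc'⟩ : ∃ c ∈ range a, c ∉ image f {u ∈ S | G.Adj v u} := by
    apply exists_mem_notMem_of_card_lt_card
    simpa using card_image_le.trans_lt hd
  have hc'' : ∀ u ∈ S, G.Adj v u → f u ≠ c := fun u hu huv e =>
    hc' (mem_image.2 ⟨u, mem_filter.2 ⟨hu, huv⟩, e⟩)
  refine ⟨Function.update f v c, fun u hu => ?_, fun u hu w hw huw => ?_⟩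
  · rcases mem_insert.1 hu with rfl | hu'
    · simpa using hc
    · rw [Function.update_of_ne (by rintro rfl; exact hv hu')]
      exact hf u hu'
  · rcases mem_insert.1 hu with rfl | hu' <;> rcases mem_insert.1 hw with rfl | hw'
    · exact absurd huw G.irrefl
    · rw [Function.update_self, Function.update_of_ne (by rintro rfl; exact hv hw')]
      exact (hc'' w hw' huw).symm
    · rw [Function.update_self, Function.update_of_ne (by rintro rfl; exact hv hu')]
      exact hc'' u hu' huw.symm
    · rw [Function.update_of_ne (by rintro rfl; exact hv hu'),
        Function.update_of_ne (by rintro rfl; exact hv hw')]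
      exact hG u hu' w hw' huw

theorem colorableOn_of_card_le (h : #S ≤ a) : G.ColorableOn S a := by
  classical
  induction S using Finset.induction generalizing a with
  | empty => exact ⟨fun _ => 0, by simp, by simp⟩
  | insert v S hv ih =>
    rw [card_insert_of_notMem hv] at h
    exact (ih (by omega)).insert_of_card_lt hv ((card_filter_le _ _).trans_lt (by omega))

theorem card_filter_adj_add_card_filter_compl [DecidableRel G.Adj] {v : V} (hv : v ∉ S) :
    #{u ∈ S | G.Adj v u} + #{u ∈ S | Gᶜ.Adj v u} = #S := by
  rw [← card_filter_add_card_filter_not (s := S) (G.Adj v)]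
  congr 2
  refine filter_congr fun u hu => ?_
  rw [compl_adj, and_iff_right]
  rintro rfl
  exact hv hu

/-- The Nordhaus-Gaddum inequality. -/
theorem add_lt_card_of_not_colorableOn (h : ¬ G.ColorableOn S a) (h' : ¬ Gᶜ.ColorableOn S b) :
    a + b < #S := by
  classical
  induction S using Finset.induction generalizing a b with
  | empty => exact absurd (colorableOn_of_card_le (by simp)) h
  | insert v S hv ih =>
    have ha : a < #(insert v S) := by by_contra! k; exact h (colorableOn_of_card_le k)
    have hb : b < #(insert v S) := by by_contra! k; exact h' (colorableOn_of_card_le k)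
    by_contra! hab
    have e : insert v S = S ∪ {v} := by rw [union_comm]; rfl
    rw [card_insert_of_notMem hv] at ha hb hab
    have hd := card_filter_adj_add_card_filter_compl (G := G) hv
    -- If `v` has fewer than `a` neighbours in `S`, it extends `a`-colourings of `G` greedily, while
    -- in `Gᶜ` it can always receive a colour of its own. Otherwise it has fewer than `b` neighbours
    -- in the complement and the roles are exchanged. Either way one vertex and one colour are lost.
    rcases lt_or_ge #{u ∈ S | G.Adj v u} a with k | k
    · obtain ⟨b, rfl⟩ := Nat.exists_eq_succ_of_ne_zero (n := b) (by omega)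
      have := ih (a := a) (b := b) (fun k' => h (k'.insert_of_card_lt hv k)) fun k' => h' (by
        rw [e]; exact k'.union (colorableOn_of_card_le (card_singleton v).le))
      omega
    · obtain ⟨a, rfl⟩ := Nat.exists_eq_succ_of_ne_zero (n := a) (by omega)
      have := ih (a := a) (b := b) (fun k' => h (by
        rw [e]; exact k'.union (colorableOn_of_card_le (card_singleton v).le)))
        (fun k' => h' (k'.insert_of_card_lt hv (by omega)))
      omega

variable [Fintype V] [DecidableRel G.Adj]

/-- If the Nordhaus-Gaddum inequality is sharp, then a vertex of large degree is adjacent to every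
vertex whose degree is not small. -/
theorem adj_of_le_degree (h : ¬ G.Colorable a) (h' : ¬ Gᶜ.Colorable b)
    (hab : a + b + 1 = Fintype.card V) {u v : V} (huv : u ≠ v) (hu : a ≤ G.degree u)
    (hv : a < G.degree v) : G.Adj u v := by
  by_contra hn
  set S : Finset V := univ.erase v with hS
  set T : Finset V := S.erase u with hT
  have hvS : v ∉ S := by simp [S]
  have huT : u ∉ T := by simp [T]
  have e : insert v S = univ := by simp [S]
  have e' : insert u T = S := by rw [hT, insert_erase]; simp [S, huv]
  have cS : #S + 1 = Fintype.card V := by rw [← card_insert_of_notMem hvS, e, card_univ]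
  have cT : #T + 1 = #S := by rw [← card_insert_of_notMem huT, e']
  have d1 : #{w ∈ S | G.Adj v w} = G.degree v := by
    rw [← card_neighborFinset_eq_degree]; congr 1; ext w
    simp only [mem_filter, mem_neighborFinset, S, mem_erase, mem_univ, and_true,
      and_iff_right_iff_imp]
    exact fun h => h.ne'
  have d2 : #{w ∈ T | G.Adj u w} = G.degree u := by
    rw [← card_neighborFinset_eq_degree]; congr 1; ext w
    simp only [mem_filter, mem_neighborFinset, T, S, mem_erase, mem_univ, and_true,
      and_iff_right_iff_imp]
    exact fun h => ⟨h.ne', by rintro rfl; exact hn h⟩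
  have c1 := card_filter_adj_add_card_filter_compl (G := G) hvS
  have c2 := card_filter_adj_add_card_filter_compl (G := G) huT
  rw [← colorableOn_univ] at h h'
  -- In the complement both deleted vertices have fewer than `b` neighbours among the vertices
  -- already coloured, so they can be put back greedily.
  have k' : ¬ Gᶜ.ColorableOn T b := fun k => h' (by
    rw [← e]
    refine ColorableOn.insert_of_card_lt ?_ hvS (by omega)
    rw [← e']
    exact k.insert_of_card_lt huT (by omega))
  -- In `G` the nonadjacent pair `u`, `v` is a single new colour class. For `a = 0` the subtraction
  -- truncates, but then `T` has fewer than `b` vertices, contrary to `k'`.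
  have k : ¬ G.ColorableOn T (a - 1) := fun k => h (by
    have := k.union (T := {u, v}) (b := 1) (colorableOn_one (by
      simp [hn, mt G.adj_symm hn]))
    rcases Nat.eq_zero_or_pos a with rfl | ha
    · exact absurd (colorableOn_of_card_le (by omega)) k'
    · rw [Nat.sub_add_cancel ha] at this
      refine this.mono_left fun w _ => ?_
      simp only [T, S, mem_union, mem_erase, mem_univ, mem_insert, mem_singleton]
      tauto)
  have := add_lt_card_of_not_colorableOn k k'
  omega

/-- Vertices of degree less than `a` are irrelevant for colourings with `a` colours. -/
theorem colorable_of_colorableOn_le_degree (h : G.ColorableOn {v | a ≤ G.degree v} a) :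
    G.Colorable a := by
  rw [← colorableOn_univ]
  suffices ∀ T : Finset V, (∀ v ∈ T, G.degree v < a) →
      G.ColorableOn (({v | a ≤ G.degree v} : Finset V) ∪ T) a by
    refine (this {v | G.degree v < a} (by simp)).mono_left fun v _ => ?_
    simpa using le_or_gt _ _
  intro T hT
  induction T using Finset.induction with
  | empty => simpa using h
  | insert v T hv ih =>
    rw [union_insert]
    refine (ih fun u hu => hT u (mem_insert_of_mem hu)).insert_of_card_lt ?_ ?_
    · have := hT v (mem_insert_self _ _)
      simp [hv, this]
    · refine lt_of_le_of_lt (card_le_card ?_) (hT v (mem_insert_self _ _))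
      intro w; simp +contextual

end ColorableOn

end SimpleGraph

/-! ### Regular graphs whose complement has a large chromatic number -/

namespace SimpleGraph

open Finset

variable {V : Type*} [Fintype V] [DecidableEq V]

/-- An involution that moves every vertex to a neighbour or fixes it. -/
structure IsMatchingMap (G : SimpleGraph V) (σ : V → V) : Prop where
  invol : ∀ v, σ (σ v) = v
  adj : ∀ v, σ v ≠ v → G.Adj v (σ v)

/-- The vertices not covered by a matching. -/
def fixedVertices (σ : V → V) : Finset V := {v | σ v = v}

@[simp] theorem mem_fixedVertices {σ : V → V} {v : V} : v ∈ fixedVertices σ ↔ σ v = v := by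
  simp [fixedVertices]

/-- A matching that covers as many vertices as possible. -/
structure IsMaximumMatchingMap (G : SimpleGraph V) (σ : V → V) : Prop
    extends IsMatchingMap G σ where
  le : ∀ τ, IsMatchingMap G τ → #(fixedVertices σ) ≤ #(fixedVertices τ)

variable {G : SimpleGraph V} {σ : V → V}

theorem exists_isMaximumMatchingMap (G : SimpleGraph V) :
    ∃ σ, IsMaximumMatchingMap G σ := by
  classical
  have h : ∃ f, ∃ σ, IsMatchingMap G σ ∧ #(fixedVertices σ) = f :=
    ⟨_, id, ⟨fun _ => rfl, fun _ h => absurd rfl h⟩, rfl⟩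
  obtain ⟨σ, hσ, hf⟩ := Nat.find_spec h
  exact ⟨σ, hσ, fun τ hτ => hf ▸ Nat.find_min' h ⟨τ, hτ, rfl⟩⟩

omit [Fintype V] in
/-- The edges of a matching and the remaining vertices are colour classes of the complement. -/
theorem IsMatchingMap.exists_colorableOn_compl (hσ : IsMatchingMap G σ) (S : Finset V)
    (hS : ∀ v ∈ S, σ v ∈ S) :
    ∃ c, 2 * c = #S + #{v ∈ S | σ v = v} ∧ Gᶜ.ColorableOn S c := by
  induction S using Finset.strongInduction with
  | H S ih =>
    rcases S.eq_empty_or_nonempty with rfl | ⟨v, hv⟩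
    · exact ⟨0, by simp, colorableOn_of_card_le (by simp)⟩
    · have hsub : S \ {v, σ v} ⊂ S := by
        refine Finset.ssubset_iff_subset_ne.2 ⟨sdiff_subset, fun e => ?_⟩
        rw [← e] at hv
        simp at hv
      obtain ⟨c, hc, hcol⟩ := ih (S \ {v, σ v}) hsub fun w hw => by
        simp only [mem_sdiff, mem_insert, mem_singleton, not_or] at hw ⊢
        refine ⟨hS w hw.1, fun e => hw.2.2 ?_, fun e => hw.2.1 ?_⟩
        · rw [← e, hσ.invol]
        · rw [← hσ.invol w, e, hσ.invol]
      have h1 : ({v, σ v} : Finset V) ⊆ S := by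
        simp [insert_subset_iff, hv, hS v hv]
      have hcol' := hcol.union (T := {v, σ v}) (b := 1) (colorableOn_one (by
        rcases eq_or_ne (σ v) v with e | e
        · simp [e]
        · have := hσ.adj v e
          simp [this, this.symm]))
      rw [sdiff_union_of_subset h1] at hcol'
      refine ⟨c + 1, ?_, hcol'⟩
      have c1 := card_sdiff_add_card_eq_card h1
      have e1 : {w ∈ S | σ w = w} = {w ∈ S \ {v, σ v} | σ w = w} ∪ {w ∈ ({v, σ v} : Finset V) | σ w = w} := by
        rw [← filter_union, sdiff_union_of_subset h1]
      have c2 := congrArg card e1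
      rw [card_union_of_disjoint (disjoint_filter_filter sdiff_disjoint)] at c2
      rcases eq_or_ne (σ v) v with e | e
      · rw [e] at c1 c2 hc
        simp [filter_singleton, e] at c1 c2 hc
        omega
      · rw [card_pair e.symm] at c1
        rw [filter_insert, if_neg e, filter_singleton, if_neg (by rw [hσ.invol]; exact e.symm)] at c2
        simp at c2
        omega

namespace IsMaximumMatchingMap

variable (hσ : IsMaximumMatchingMap G σ)
include hσ

/-- Otherwise the edge could be added to the matching. -/
theorem not_adj {u w : V} (hu : σ u = u) (hw : σ w = w) : ¬ G.Adj u w := by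
  intro h
  have h' : IsMatchingMap G fun v => if v = u then w else if v = w then u else σ v := by
    have h1 := hσ.invol
    have h2 := hσ.adj
    have := h.ne
    have := h.symm
    constructor <;> intro v <;> grind
  refine absurd (hσ.le _ h') (not_le.2 (card_lt_card (ssubset_iff_of_subset ?_ |>.2 ⟨u, ?_⟩)))
  · intro v
    simp only [mem_fixedVertices]
    grind
  · simp [hu, h.ne']

/-- Replace an edge `x, σ x` of a maximum matching by an edge `u, x`. -/
theorem rotate {u x : V} (hu : σ u = u) (h : G.Adj u x) :
    ∃ τ, IsMaximumMatchingMap G τ ∧ #(fixedVertices τ) = #(fixedVertices σ) ∧ τ u = x ∧ τ x = u ∧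
      τ (σ x) = σ x ∧ ∀ v, v ≠ u → v ≠ x → v ≠ σ x → τ v = σ v := by
  have hx : σ x ≠ x := fun hx => hσ.not_adj hu hx h
  have h1 := hσ.invol
  have h2 := hσ.adj
  have hne := h.ne
  have hs := h.symm
  have hc : #(fixedVertices fun v => if v = u then x else if v = x then u else
      if v = σ x then σ x else σ v) = #(fixedVertices σ) := by
    have : fixedVertices (fun v => if v = u then x else if v = x then u else
      if v = σ x then σ x else σ v) = insert (σ x) ((fixedVertices σ).erase u) := by
      ext v
      simp only [mem_fixedVertices, mem_insert, mem_erase]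
      grind
    rw [this, card_insert_of_notMem, card_erase_add_one]
    · simpa using hu
    · simp only [mem_erase, mem_fixedVertices]
      grind
  refine ⟨fun v => if v = u then x else if v = x then u else if v = σ x then σ x else σ v,
    ⟨⟨fun v => ?_, fun v => ?_⟩, fun τ hτ => hc ▸ hσ.le τ hτ⟩, hc, ?_, ?_, ?_, ?_⟩
  iterate 5 grind
  intro v _ _ _
  grind

end IsMaximumMatchingMap

/-- A fixed vertex of a maximum matching is adjacent to exactly one end of each matching edge. -/
def SplitsEdges (G : SimpleGraph V) : Prop :=
  ∀ σ, IsMaximumMatchingMap G σ → ∀ u, σ u = u → ∀ x, x ≠ u → (G.Adj u x ↔ ¬ G.Adj u (σ x))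

/-! ### Alternating-path rotations around an uncovered vertex -/

namespace SplitsEdges

variable (hG : SplitsEdges G) (hσ : IsMaximumMatchingMap G σ) {u x y z : V} (hu : σ u = u)
  (hx : G.Adj u x) (hy : G.Adj u y) (hz : G.Adj u z) (hxy : x ≠ y) (hxz : x ≠ z) (hyz : y ≠ z)

-- Each nonadjacency is the splitting property for a rotated matching. Moving the uncovered vertex
-- from `u` to `σ x` (or `σ y`) settles the mixed pairs; rotating once more along `σ x`, `σ y`, `y`
-- uncovers `y` while `u`, `x` stay matched, so `y`, being adjacent to `u`, misses `x`.
include hG hσ hu hx hy hxy in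
theorem of_adj (h : G.Adj (σ x) (σ y)) :
    ¬ G.Adj x y ∧ ¬ G.Adj x (σ y) ∧ ¬ G.Adj y (σ x) := by
  have hi := hσ.invol
  have hux := hx.ne
  have huy := hy.ne
  have nx := (hG σ hσ u hu x hux.symm).1 hx
  have ny := (hG σ hσ u hu y huy.symm).1 hy
  obtain ⟨τ, hτ, -, t1, t2, t3, t4⟩ := hσ.rotate hu hx
  obtain ⟨ρ, hρ, -, r1, r2, r3, r4⟩ := hσ.rotate hu hy
  have a1 : y ≠ σ x := by rintro rfl; exact nx hy
  have a2 : x ≠ σ y := by rintro rfl; exact ny hx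
  have a4 : σ x ≠ σ y := h.ne
  have a5 : σ y ≠ u := fun e => huy (by rw [← hi y, e, hu])
  have a6 : σ x ≠ u := fun e => hux (by rw [← hi x, e, hu])
  have p1 := hG τ hτ (σ x) t3 y a1
  rw [t4 y huy.symm hxy.symm a1] at p1
  have p2 := hG ρ hρ (σ y) r3 x a2
  rw [r4 x hux.symm hxy a2] at p2
  have b1 : ¬ G.Adj y (σ x) := fun k => p1.1 k.symm h
  have b2 : ¬ G.Adj x (σ y) := fun k => p2.1 k.symm h.symm
  obtain ⟨π, hπ, -, q1, q2, q3, q4⟩ := hτ.rotate t3 h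
  rw [t4 (σ y) a5 a2.symm a4.symm, hi] at q3
  have p3 := hG π hπ y q3 u huy
  rw [q4 u a6.symm a5.symm (by rw [t4 (σ y) a5 a2.symm a4.symm, hi]; exact huy), t1] at p3
  exact ⟨fun k => p3.1 hy.symm k.symm, b2, b1⟩

-- After rotation `σ x` is uncovered and must see exactly one of `y`, `σ y`; likewise for `σ y`.
include hG hσ hu hx hy hxy in
theorem of_not_adj (h : ¬ G.Adj (σ x) (σ y)) : G.Adj x (σ y) ∧ G.Adj y (σ x) := by
  have hux := hx.ne
  have huy := hy.ne
  have nx := (hG σ hσ u hu x hux.symm).1 hx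
  have ny := (hG σ hσ u hu y huy.symm).1 hy
  obtain ⟨τ, hτ, -, t1, t2, t3, t4⟩ := hσ.rotate hu hx
  obtain ⟨ρ, hρ, -, r1, r2, r3, r4⟩ := hσ.rotate hu hy
  have a1 : y ≠ σ x := by rintro rfl; exact nx hy
  have a2 : x ≠ σ y := by rintro rfl; exact ny hx
  have p1 := hG τ hτ (σ x) t3 y a1
  rw [t4 y huy.symm hxy.symm a1] at p1
  have p2 := hG ρ hρ (σ y) r3 x a2
  rw [r4 x hux.symm hxy a2] at p2
  exact ⟨(p2.2 fun k => h k.symm).symm, (p1.2 h).symm⟩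

-- If `σ x` missed `σ z`, it would see `z`. Then `of_adj` and `of_not_adj`, applied both at `u` to
-- `y`, `z` and at the newly uncovered `σ x` to `σ y`, `z`, contradict each other.
include hG hσ hu hx hy hz hxy hxz hyz in
theorem adj_of_adj (h : G.Adj (σ x) (σ y)) : G.Adj (σ x) (σ z) := by
  by_contra h'
  have hi := hσ.invol
  have ny := (hG σ hσ u hu y hy.ne').1 hy
  have nz := (hG σ hσ u hu z hz.ne').1 hz
  obtain ⟨τ, hτ, -, t1, t2, t3, t4⟩ := hσ.rotate hu hx
  have o1 := hG.of_adj hσ hu hx hy hxy h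
  have o2 := hG.of_not_adj hσ hu hx hz hxz h'
  have e1 : τ (σ y) = y := by
    rw [t4 (σ y) (fun e => hy.ne (by rw [← hi y, e, hu])) (by rintro rfl; exact ny hx) h.ne', hi]
  have e2 : τ z = σ z := t4 z hz.ne' hxz.symm o2.2.ne
  have hne : σ y ≠ z := by rintro e; rw [e] at ny; exact ny hz
  by_cases k : G.Adj y (σ z)
  · have r := hG.of_adj hτ t3 h o2.2.symm hne (by rwa [e1, e2])
    by_cases l : G.Adj (σ y) (σ z)
    · exact (hG.of_adj hσ hu hy hz hyz l).2.1 k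
    · exact r.1 (hG.of_not_adj hσ hu hy hz hyz l).2.symm
  · have r := hG.of_not_adj hτ t3 h o2.2.symm hne (by rwa [e1, e2])
    rw [e1, e2] at r
    exact (hG.of_adj hσ hu hy hz hyz r.1).1 r.2.symm

-- By `adj_of_adj` the partners of `x`, `y`, `z` form a triangle. At `u` this forbids `y z` and `z
-- (σ y)` as edges; seen from the uncovered vertex `σ x`, the missing edge `y z` requires `z (σ y)`.
include hG hσ hu hx hy hz hxy hxz hyz in
theorem not_adj (h : G.Adj (σ x) (σ y)) : False := by
  have h' := hG.adj_of_adj hσ hu hx hy hz hxy hxz hyz h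
  have h'' := hG.adj_of_adj hσ hu hy hx hz hxy.symm hyz hxz h.symm
  have hi := hσ.invol
  have ny := (hG σ hσ u hu y hy.ne').1 hy
  have nz := (hG σ hσ u hu z hz.ne').1 hz
  obtain ⟨τ, hτ, -, t1, t2, t3, t4⟩ := hσ.rotate hu hx
  have e1 : τ (σ y) = y := by
    rw [t4 (σ y) (fun e => hy.ne (by rw [← hi y, e, hu])) (by rintro rfl; exact ny hx) h.ne', hi]
  have e2 : τ (σ z) = z := by
    rw [t4 (σ z) (fun e => hz.ne (by rw [← hi z, e, hu])) (by rintro rfl; exact nz hx) h'.ne', hi]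
  have o := hG.of_adj hσ hu hy hz hyz h''
  have r := hG.of_not_adj hτ t3 h h' h''.ne (by rw [e1, e2]; exact o.1)
  rw [e1, e2] at r
  exact o.2.2 r.1.symm

end SplitsEdges

variable [DecidableRel G.Adj] {d : ℕ}

/-- Two neighbours of `u` have adjacent partners; by `SplitsEdges.not_adj` there is then no third
neighbour. -/
theorem SplitsEdges.eq_two (hG : SplitsEdges G) (hd : ∀ v, G.degree v = d) (hd0 : d ≠ 0)
    (hσ : IsMaximumMatchingMap G σ) {u : V} (hu : σ u = u) (huniq : ∀ v, σ v = v → v = u) :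
    d = 2 := by
  obtain ⟨x, hx⟩ : ∃ x, G.Adj u x := by
    rw [← G.degree_pos_iff_exists_adj, hd]; omega
  have hxx : σ x ≠ x := fun e => hx.ne' (huniq x e)
  have nx := (hG σ hσ u hu x hx.ne').1 hx
  obtain ⟨y, hy, hyx, h⟩ : ∃ y, G.Adj u y ∧ y ≠ x ∧ G.Adj (σ x) (σ y) := by
    -- Otherwise `x` is adjacent to `u`, to `σ x` and to the partners of the other `d - 1`
    -- neighbours of `u`: `d + 1` vertices in all.
    by_contra! h
    have hsub : insert u (insert (σ x) (((G.neighborFinset u).erase x).image σ)) ⊆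
        G.neighborFinset x := by
      intro v hv
      simp only [mem_insert, mem_image, mem_erase, mem_neighborFinset] at hv ⊢
      rcases hv with rfl | rfl | ⟨y, ⟨hyx, hy⟩, rfl⟩
      · exact hx.symm
      · exact hσ.adj x hxx
      · exact (hG.of_not_adj hσ hu hx hy hyx.symm (h y hy hyx)).1
    have hc := card_le_card hsub
    have hinj : Function.Injective σ := fun a b e => by rw [← hσ.invol a, e, hσ.invol]
    rw [card_insert_of_notMem, card_insert_of_notMem, card_image_of_injective _ hinj,
      card_erase_of_mem (by simpa using hx), card_neighborFinset_eq_degree,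
      card_neighborFinset_eq_degree, hd, hd] at hc
    · omega
    · simp only [mem_image, mem_erase, mem_neighborFinset, not_exists, not_and]
      rintro y ⟨hyx, -⟩ e
      exact hyx (hinj e)
    · simp only [mem_insert, mem_image, mem_erase, mem_neighborFinset, not_or, not_exists, not_and]
      refine ⟨fun e => hx.ne (by rw [← hσ.invol x, ← e, hu]), ?_⟩
      rintro y ⟨-, hy⟩ e
      exact hy.ne (by rw [← hσ.invol y, e, hu])
  have : G.neighborFinset u = {x, y} := by
    ext z
    simp only [mem_neighborFinset, mem_insert, mem_singleton]
    constructor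
    · intro hz
      by_contra! hne
      exact hG.not_adj hσ hu hx hy hz hyx.symm hne.1.symm hne.2.symm h
    · rintro (rfl | rfl) <;> assumption
  rw [← hd u, ← card_neighborFinset_eq_degree, this, card_pair hyx.symm]

/-- Double counting the edges between uncovered and covered vertices is tight for every maximum
matching. Tightness leaves only one uncovered vertex, hence the splitting property and `d = 2`, with
`2 * d + 1` vertices. -/
theorem eq_two_of_not_colorable_compl (hd : ∀ v, G.degree v = d) (hd0 : d ≠ 0)
    (hm : 2 * d + 1 ≤ Fintype.card V) (hcol : ¬ Gᶜ.Colorable (Fintype.card V - 1 - d)) :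
    d = 2 ∧ Fintype.card V = 5 := by
  -- every maximum matching leaves `card V - 2 * d` vertices
  have key : ∀ σ, IsMaximumMatchingMap G σ → #(fixedVertices σ) + 2 * d = Fintype.card V ∧
      ∀ x, σ x ≠ x → (∀ u, σ u = u → (G.Adj u x ↔ ¬ G.Adj u (σ x))) ∧
        ((∀ u, σ u = u → G.Adj u x) ∨ ∀ u, σ u = u → ¬ G.Adj u x) := by
    intro σ hσ
    have hi := hσ.invol
    have hinj : Function.Injective σ := fun a b e => by rw [← hσ.invol a, e, hσ.invol]
    set U := fixedVertices σ with hU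
    set N : V → Finset V := fun x => {u ∈ U | G.Adj u x} with hN
    have hUm : ∀ u, u ∈ U ↔ σ u = u := fun u => mem_fixedVertices
    have hNU : ∀ x, #(N x) ≤ #U := fun x => card_le_card (filter_subset _ _)
    obtain ⟨c, hc, hcc⟩ := hσ.exists_colorableOn_compl univ (by simp)
    have hc' : 2 * c = Fintype.card V + #U := hc
    -- With `m` vertices this says `#U ≥ m - 2 * d`, the lower bound that the edge count has to
    -- match.
    have hlt : Fintype.card V - 1 - d < c := by
      by_contra! k; exact hcol (colorableOn_univ.1 (hcc.mono k))
    have hUle : #U ≤ Fintype.card V := card_le_univ _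
    -- Distinct `u`, `w` would give an augmenting path `u`, `x`, `σ x`, `w`.
    have hsame : ∀ x, σ x ≠ x → ∀ u ∈ N x, ∀ w ∈ N (σ x), u = w := by
      intro x hx u hu w hw
      by_contra hne
      simp only [N, mem_filter, hUm] at hu hw
      obtain ⟨τ, hτ, -, t1, t2, t3, t4⟩ := hσ.rotate hu.1 hu.2
      refine hτ.not_adj t3 (u := σ x) (w := w) ?_ hw.2.symm
      rw [t4 w (Ne.symm hne) (by rintro rfl; exact hx hw.1) (by rintro rfl; exact hw.2.ne rfl),
        hw.1]
    -- With a single uncovered vertex a triangle on a matching edge would break this bound; such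
    -- triangles are excluded only in `htri`.
    have hpair : ∀ x, σ x ≠ x → 2 ≤ #U → #(N x) + #(N (σ x)) ≤ #U := by
      intro x hx h2
      rcases (N x).eq_empty_or_nonempty with e | ⟨u, hu⟩
      · rw [e]; simpa using hNU _
      rcases (N (σ x)).eq_empty_or_nonempty with e | ⟨w, hw⟩
      · rw [e]; simpa using hNU _
      have h1 : #(N x) ≤ 1 := card_le_one.2 fun a ha b hb => by
        rw [hsame x hx a ha w hw, hsame x hx b hb w hw]
      have h2 : #(N (σ x)) ≤ 1 := card_le_one.2 fun a ha b hb => by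
        rw [← hsame x hx u hu a ha, ← hsame x hx u hu b hb]
      omega
    have hsum1 : ∑ x ∈ Uᶜ, #(N x) = #U * d := by
      have := sum_card_bipartiteAbove_eq_sum_card_bipartiteBelow (s := U) (t := Uᶜ) G.Adj
      rw [show ∑ x ∈ Uᶜ, #(N x) = ∑ x ∈ Uᶜ, #(bipartiteBelow G.Adj U x) from rfl, ← this,
        ← smul_eq_mul, ← sum_const]
      refine sum_congr rfl fun u hu => ?_
      rw [← hd u, ← card_neighborFinset_eq_degree]
      congr 1
      ext w
      simp only [bipartiteAbove, mem_filter, mem_compl, mem_neighborFinset, hUm,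
        and_iff_right_iff_imp]
      exact fun h e => hσ.not_adj ((hUm u).1 hu) e h
    have hsum2 : ∑ x ∈ Uᶜ, #(N (σ x)) = #U * d := by
      rw [← hsum1]
      refine sum_bij (fun x _ => σ x) (fun x hx => ?_) (fun _ _ _ _ e => hinj e)
        (fun x hx => ⟨σ x, ?_, hi x⟩) fun _ _ => rfl <;>
      · simp only [mem_compl, hUm] at hx ⊢
        exact fun e => hx (hinj e)
    have hsum : ∑ x ∈ Uᶜ, (#(N x) + #(N (σ x))) = 2 * d * #U := by
      rw [sum_add_distrib, hsum1, hsum2]; ring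
    have hcU : #Uᶜ = Fintype.card V - #U := card_compl U
    have hcard : #U + 2 * d = Fintype.card V := by
      rcases lt_or_ge #U 2 with h | h
      · omega
      · have := sum_le_card_nsmul Uᶜ (fun x => #(N x) + #(N (σ x))) #U fun x hx =>
          hpair x (by simpa [hUm] using hx) h
        rw [hsum, hcU, smul_eq_mul] at this
        have := Nat.le_of_mul_le_mul_right this (by omega)
        omega
    -- Otherwise `u`, `x`, `σ x` is a triangle. Used as one colour class of `Gᶜ` in place of the
    -- edge and the singleton `u`, it saves one colour, which is enough for a forbidden colouring.
    have htri : ∀ x, σ x ≠ x → N x = ∅ ∨ N (σ x) = ∅ := by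
      intro x hx
      by_contra! hne
      obtain ⟨⟨u, hu⟩, ⟨w, hw⟩⟩ := hne
      obtain rfl := hsame x hx u hu w hw
      simp only [N, mem_filter, hUm] at hu hw
      set T : Finset V := {u, x, σ x} with hT
      have hTc : #T = 3 := card_eq_three.2 ⟨u, x, σ x, hu.2.ne, hw.2.ne, hx.symm, rfl⟩
      have hmT : ∀ v, v ∈ T ↔ v = u ∨ v = x ∨ v = σ x := by simp [T]
      obtain ⟨c', hc1, hc2⟩ := hσ.exists_colorableOn_compl Tᶜ (by
        intro v hv
        simp only [mem_compl, hmT, not_or] at hv ⊢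
        refine ⟨fun e => hv.1 ?_, fun e => hv.2.2 ?_, fun e => hv.2.1 (hinj e)⟩
        · rw [← hi v, e, hu.1]
        · rw [← hi v, e])
      have e : ({v ∈ Tᶜ | σ v = v} : Finset V) = U.erase u := by
        ext v
        simp only [mem_filter, mem_compl, hmT, mem_erase, hUm]
        constructor
        · rintro ⟨h1, h2⟩; exact ⟨fun e => h1 (Or.inl e), h2⟩
        · rintro ⟨h1, h2⟩
          refine ⟨?_, h2⟩
          rintro (h | h | h)
          · exact h1 h
          · exact hx (h ▸ h2)
          · rw [h, hi] at h2; exact hx h2.symm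
      have hc3 := card_erase_add_one ((hUm u).2 hu.1)
      rw [e, card_compl, hTc] at hc1
      have := hc2.union (T := T) (b := 1) (colorableOn_one (by
        have h1 := hσ.adj x hx
        simp [T, hu.2, hu.2.symm, hw.2, hw.2.symm, h1, h1.symm]))
      rw [union_comm, union_compl, colorableOn_univ] at this
      have h3 : 3 ≤ Fintype.card V := hTc ▸ card_le_univ T
      exact hcol (this.mono (by omega))
    have hle : ∀ x ∈ Uᶜ, #(N x) + #(N (σ x)) ≤ #U := by
      intro x hx
      rcases htri x (by simpa [hUm] using hx) with e | e <;> rw [e] <;> simpa using hNU _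
    -- The sum of these bounds equals `#U * 2 * d`, the exact total, so each is an equality. With
    -- `htri`, one end of every matching edge sees all of `U` and the other end none of it.
    have heq : ∀ x ∈ Uᶜ, #(N x) + #(N (σ x)) = #U := by
      refine (sum_eq_sum_iff_of_le hle).1 ?_
      rw [hsum, sum_const, smul_eq_mul, hcU, ← hcard]
      congr 1; omega
    refine ⟨hcard, fun x hx => ?_⟩
    have h1 := heq x (by simpa [hUm] using hx)
    have hful : ∀ y, #(N y) = #U → ∀ u, σ u = u → G.Adj u y := fun y hy u hu =>
      (mem_filter.1 ((eq_of_subset_of_card_le (filter_subset _ _) hy.ge).ge ((hUm u).2 hu))).2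
    have hemp : ∀ y, N y = ∅ → ∀ u, σ u = u → ¬ G.Adj u y := fun y hy u hu h => by
      have : u ∈ N y := mem_filter.2 ⟨(hUm u).2 hu, h⟩
      simp [hy] at this
    rcases htri x hx with e | e <;> rw [e, card_empty] at h1
    · have a := hemp x e
      have b := hful (σ x) (by omega)
      exact ⟨fun u hu => iff_of_false (a u hu) (not_not.2 (b u hu)), Or.inr a⟩
    · have a := hemp (σ x) e
      have b := hful x (by omega)
      exact ⟨fun u hu => iff_of_true (b u hu) (a u hu), Or.inl b⟩
  obtain ⟨σ, hσ⟩ := exists_isMaximumMatchingMap G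
  obtain ⟨hcard, hspl⟩ := key σ hσ
  have hi := hσ.invol
  obtain ⟨u, hu⟩ : ∃ u, σ u = u := by
    have : 0 < #(fixedVertices σ) := by omega
    obtain ⟨u, hu⟩ := card_pos.1 this
    exact ⟨u, mem_fixedVertices.1 hu⟩
  have huniq : ∀ v, σ v = v → v = u := by
    by_contra! hw
    obtain ⟨w, hw, hwu⟩ := hw
    -- An edge `y z` between two non-neighbours of `u` would yield the augmenting path `u`, `σ y`,
    -- `y`, `z`, `σ z`, `w`; it is carried out as two rotations, after which `σ z` and `w` are
    -- uncovered and adjacent.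
    have hsub : ∀ y, ¬ G.Adj u y → G.neighborFinset y ⊆ G.neighborFinset u := by
      intro y hy z hz
      rw [mem_neighborFinset] at hz ⊢
      by_contra hz'
      rcases eq_or_ne (σ y) y with ey | ey
      · have ez : σ z ≠ z := fun ez => hσ.not_adj ey ez hz
        exact ((hspl z ez).2.resolve_left fun h => hz' (h u hu)) y ey hz
      rcases eq_or_ne (σ z) z with ez | ez
      · exact ((hspl y ey).2.resolve_left fun h => hy (h u hu)) z ez hz.symm
      have h1 : G.Adj u (σ y) := by
        by_contra k; exact hy (((hspl y ey).1 u hu).2 k)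
      have h2 : G.Adj w (σ z) := by
        by_contra k
        have := ((hspl z ez).1 w hw).2 k
        exact ((hspl z ez).2.resolve_left fun h => hz' (h u hu)) w hw this
      obtain ⟨τ, hτ, -, t1, t2, t3, t4⟩ := hσ.rotate hu h1
      rw [hi] at t3 t4
      obtain ⟨ρ, hρ, -, r1, r2, r3, r4⟩ := hτ.rotate t3 hz
      have n1 : z ≠ σ y := by rintro rfl; exact hz' h1
      have n2 : z ≠ u := by rintro rfl; exact ez hu
      have e1 : τ z = σ z := t4 z n2 n1 hz.ne'
      rw [e1] at r3 r4
      refine hρ.not_adj (u := w) (w := σ z) ?_ r3 h2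
      rw [r4 w (by rintro rfl; exact ey hw) (by rintro rfl; exact ez hw) h2.ne,
        t4 w hwu (by rintro rfl; rw [hi] at hw; exact ey hw.symm) (by rintro rfl; exact ey hw), hw]
    have hsame : ∀ y, ¬ G.Adj u y → G.neighborFinset y = G.neighborFinset u := fun y hy =>
      eq_of_subset_of_card_le (hsub y hy) (by simp [hd])
    obtain ⟨x, hx⟩ : ∃ x, G.Adj u x := by
      rw [← G.degree_pos_iff_exists_adj, hd]; omega
    -- All non-neighbours of `u` have the same neighbourhood as `u`, so the neighbour `x` of `u`
    -- sees all of them: `card V - d ≤ d`, against `2 * d + 1 ≤ card V`.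
    have hc : (G.neighborFinset u)ᶜ ⊆ G.neighborFinset x := by
      intro y hy
      rw [mem_compl, mem_neighborFinset] at hy
      have : x ∈ G.neighborFinset y := by rw [hsame y hy]; simpa using hx
      simpa using ((mem_neighborFinset _ _ _).1 this).symm
    have := card_le_card hc
    rw [card_compl, card_neighborFinset_eq_degree, card_neighborFinset_eq_degree, hd, hd] at this
    omega
  have hone : #(fixedVertices σ) = 1 :=
    card_eq_one.2 ⟨u, by ext v; simp only [mem_fixedVertices, mem_singleton]
                         exact ⟨huniq v, by rintro rfl; exact hu⟩⟩
  have hspl' : SplitsEdges G := by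
    intro τ hτ v hv x hx
    have h1 : #(fixedVertices τ) ≤ 1 := hone ▸ hτ.le σ hσ.toIsMatchingMap
    have hxx : τ x ≠ x := fun e =>
      hx (card_le_one.1 h1 x (mem_fixedVertices.2 e) v (mem_fixedVertices.2 hv))
    exact ((key τ hτ).2 x hxx).1 v hv
  have := hspl'.eq_two hd hd0 hσ hu huniq
  omega

/-- A 2-regular graph on five vertices is a 5-cycle. -/
theorem nonempty_iso_cycleGraph_five (hV : Fintype.card V = 5) (hd : ∀ v, G.degree v = 2) :
    Nonempty (G ≃g cycleGraph 5) := by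
  have hN : ∀ v a b, G.Adj v a → G.Adj v b → a ≠ b → ∀ w, G.Adj v w → w = a ∨ w = b := by
    intro v a b ha hb hab w hw
    by_contra! h
    have : ({a, b, w} : Finset V) ⊆ G.neighborFinset v := by
      simp [insert_subset_iff, ha, hb, hw]
    have := card_le_card this
    rw [card_eq_three.2 ⟨a, b, w, hab, h.1.symm, h.2.symm, rfl⟩, card_neighborFinset_eq_degree,
      hd] at this
    omega
  have hE : ∀ v a, G.Adj v a → ∃ b, b ≠ a ∧ G.Adj v b := by
    intro v a ha
    obtain ⟨b, hb, hne⟩ := exists_mem_ne (s := G.neighborFinset v) (by simp [hd]) a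
    exact ⟨b, hne, by simpa using hb⟩
  have hF : ∀ S : Finset V, #S < 5 → ∃ v, v ∉ S := by
    intro S hS
    by_contra! h
    rw [← hV, ← card_univ] at hS
    exact absurd (card_le_card fun v _ => h v) (not_le.2 hS)
  obtain ⟨o⟩ : Nonempty V := Fintype.card_pos_iff.1 (by omega)
  obtain ⟨a, ha⟩ : ∃ a, G.Adj o a := by rw [← G.degree_pos_iff_exists_adj, hd]; omega
  obtain ⟨b, hba, hb⟩ := hE o a ha
  obtain ⟨c, hco, hc⟩ := hE a o ha.symm
  obtain ⟨e, heo, he⟩ := hE b o hb.symm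
  have No := hN o a b ha hb hba.symm
  have Na := hN a o c ha.symm hc hco.symm
  have Nb := hN b o e hb.symm he heo.symm
  have hs := fun {u v : V} (h : G.Adj u v) => h.symm
  have hirr : ∀ v, ¬ G.Adj v v := fun v => G.irrefl
  -- Otherwise `o`, `a`, `c` is a triangle whose vertices are saturated, and the two remaining
  -- vertices cannot have degree 2.
  have hcb : c ≠ b := by
    rintro rfl
    obtain ⟨p, hp⟩ := hF {o, a, c} (card_le_three.trans_lt (by omega))
    obtain ⟨q, hq⟩ := hF {o, a, c, p} (card_le_four.trans_lt (by omega))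
    obtain ⟨r, hr⟩ : ∃ r, G.Adj p r := by rw [← G.degree_pos_iff_exists_adj, hd]; omega
    obtain ⟨r', hr', hpr'⟩ := hE p r hr
    have hu : ({o, a, c, p, q} : Finset V) = univ := by
      apply eq_univ_of_card
      simp only [mem_insert, mem_singleton, not_or] at hp hq
      rw [card_insert_of_notMem, card_insert_of_notMem, card_insert_of_notMem,
        card_insert_of_notMem, card_singleton, hV] <;> simp <;> grind
    have h5 : ∀ v, v = o ∨ v = a ∨ v = c ∨ v = p ∨ v = q := fun v => by
      have := mem_univ v; rw [← hu] at this; simpa using this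
    simp only [mem_insert, mem_singleton, not_or] at hp hq
    have := h5 r
    have := h5 r'
    grind
  -- Otherwise `o`, `a`, `c`, `b` is a saturated 4-cycle and the fifth vertex is isolated.
  have hce : c ≠ e := by
    rintro rfl
    obtain ⟨p, hp⟩ := hF {o, a, b, c} (card_le_four.trans_lt (by omega))
    obtain ⟨r, hr⟩ : ∃ r, G.Adj p r := by rw [← G.degree_pos_iff_exists_adj, hd]; omega
    have Nc := hN c a b hc.symm he.symm hba.symm
    have hu : ({o, a, b, c, p} : Finset V) = univ := by
      apply eq_univ_of_card
      simp only [mem_insert, mem_singleton, not_or] at hp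
      have := ha.ne
      have := hb.ne
      rw [card_insert_of_notMem, card_insert_of_notMem, card_insert_of_notMem,
        card_insert_of_notMem, card_singleton, hV] <;> simp <;> grind
    have h5 : ∀ v, v = o ∨ v = a ∨ v = b ∨ v = c ∨ v = p := fun v => by
      have := mem_univ v; rw [← hu] at this; simpa using this
    simp only [mem_insert, mem_singleton, not_or] at hp
    have := h5 r
    grind
  have hae : a ≠ e := by
    rintro rfl
    exact hcb ((Na b he.symm).resolve_left hb.ne').symm
  have h1 := ha.ne
  have h2 := hb.ne
  have h3 := hc.ne
  have h4 := he.ne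
  have hu : ({o, a, c, e, b} : Finset V) = univ := by
    apply eq_univ_of_card
    rw [card_insert_of_notMem, card_insert_of_notMem, card_insert_of_notMem,
      card_insert_of_notMem, card_singleton, hV] <;> simp <;> grind
  have h5 : ∀ v, v = o ∨ v = a ∨ v = c ∨ v = e ∨ v = b := fun v => by
    have := mem_univ v; rw [← hu] at this; simpa using this
  have hadj : G.Adj c e := by
    obtain ⟨r, hr, hcr⟩ := hE c a hc.symm
    have := h5 r
    grind
  have Nc := hN c a e hc.symm hadj hae
  have Ne' := hN e b c he.symm hadj.symm hcb.symm
  let f : Fin 5 → V := ![o, a, c, e, b]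
  have hsurj : Function.Surjective f := by
    intro v
    rcases h5 v with rfl | rfl | rfl | rfl | rfl
    exacts [⟨0, rfl⟩, ⟨1, rfl⟩, ⟨2, rfl⟩, ⟨3, rfl⟩, ⟨4, rfl⟩]
  have hbij : Function.Bijective f :=
    (Fintype.bijective_iff_surjective_and_card f).2 ⟨hsurj, by simp [hV]⟩
  have hmap : ∀ i j, G.Adj (f i) (f j) ↔ (cycleGraph 5).Adj i j := by
    have k : ∀ i j : Fin 5, (cycleGraph 5).Adj i j ↔ (i - j = 1 ∨ j - i = 1) := fun i j =>
      cycleGraph_adj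
    intro i j
    rw [k]
    fin_cases i <;> fin_cases j <;> simp [f] <;> grind
  exact ⟨⟨(Equiv.ofBijective f hbij).symm, fun {u v} => by
    rw [← hmap]
    simp [← Equiv.ofBijective_apply f hbij]⟩⟩

end SimpleGraph

/-! ### The degree conditions characterize NG-graphs -/

namespace SimpleGraph

open Finset

section Regular

variable {V : Type*} [Fintype V] [DecidableEq V] {G : SimpleGraph V} [DecidableRel G.Adj] {d : ℕ}

/-- The regular NG-graphs. -/
theorem regular_of_not_colorable (hd : ∀ v, G.degree v = d) (hdV : d < Fintype.card V)
    (h : ¬ G.Colorable d) (h' : ¬ Gᶜ.Colorable (Fintype.card V - 1 - d)) :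
    d = 0 ∨ d + 1 = Fintype.card V ∨ d = 2 ∧ Fintype.card V = 5 := by
  by_cases hd0 : d = 0
  · exact Or.inl hd0
  by_cases hd1 : d + 1 = Fintype.card V
  · exact Or.inr (Or.inl hd1)
  refine Or.inr (Or.inr ?_)
  -- One of the graph and its complement has degree at most half of `card V - 1`; the exceptional
  -- case is the same for both.
  rcases le_total (2 * d + 1) (Fintype.card V) with hm | hm
  · exact eq_two_of_not_colorable_compl hd hd0 hm h'
  · have := eq_two_of_not_colorable_compl (G := Gᶜ) (d := Fintype.card V - 1 - d)
      (fun v => by rw [degree_compl, hd]) (by omega) (by omega) (by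
        rwa [compl_compl, show Fintype.card V - 1 - (Fintype.card V - 1 - d) = d by omega])
    omega

end Regular

theorem degree_induce_eq_card_filter {V : Type*} {G : SimpleGraph V} [DecidableRel G.Adj]
    {s : Set V} [Fintype s] {S : Finset V} (hs : ∀ v, v ∈ S ↔ v ∈ s) (v : s)
    [Fintype ((G.induce s).neighborSet v)] :
    (G.induce s).degree v = #{u ∈ S | G.Adj v u} := by
  classical
  rw [← card_neighborFinset_eq_degree]
  refine card_bij (fun u _ => (u : V)) (fun u hu => ?_) (fun _ _ _ _ e => Subtype.ext e)
    fun u hu => ?_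
  · rw [mem_neighborFinset] at hu
    exact mem_filter.2 ⟨(hs u).2 u.2, hu⟩
  · rw [mem_filter] at hu
    exact ⟨⟨u, (hs u).1 hu.1⟩, by rw [mem_neighborFinset]; exact hu.2, rfl⟩

theorem nonempty_induce_iso_cycleGraph_five_iff {V : Type*} {G : SimpleGraph V}
    [DecidableRel G.Adj] {s : Set V} {S : Finset V} (hs : ∀ v, v ∈ S ↔ v ∈ s) :
    Nonempty (G.induce s ≃g cycleGraph 5) ↔ #S = 5 ∧ ∀ v ∈ S, #{u ∈ S | G.Adj v u} = 2 := by
  classical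
  have : Fintype s := Fintype.subtype S hs
  have hc : Fintype.card s = #S := Fintype.card_of_subtype S hs
  constructor
  · rintro ⟨e⟩
    refine ⟨by rw [← hc, Fintype.card_congr e.toEquiv, Fintype.card_fin], fun v hv => ?_⟩
    rw [← degree_induce_eq_card_filter hs ⟨v, (hs v).1 hv⟩, ← e.degree_eq]
    exact cycleGraph_degree_three_le
  · rintro ⟨h5, h2⟩
    refine nonempty_iso_cycleGraph_five (by rw [hc, h5]) fun v => ?_
    rw [degree_induce_eq_card_filter hs v]
    exact h2 v ((hs v).2 v.2)

variable {V : Type*} [Fintype V] {G : SimpleGraph V}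

/-! ### NG-graphs as sharp cases of the Nordhaus-Gaddum inequality -/

section NGGraph

theorem exists_chromaticNumber_eq [Nonempty V] (G : SimpleGraph V) :
    ∃ a : ℕ, G.chromaticNumber = (a + 1 : ℕ) ∧ ¬ G.Colorable a := by
  obtain ⟨p, hp⟩ := ENat.ne_top_iff_exists.1 (chromaticNumber_ne_top_iff_exists.2
    ⟨_, G.colorable_of_fintype⟩)
  have hc : G.Colorable p := chromaticNumber_le_iff_colorable.1 hp.ge
  rcases p with _ | a
  · have := colorable_zero_iff.1 hc
    exact absurd ‹Nonempty V› (not_nonempty_iff.2 this)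
  · refine ⟨a, hp.symm, fun h => ?_⟩
    have := chromaticNumber_le_iff_colorable.2 h
    rw [← hp, Nat.cast_le] at this
    omega

/-- If the Nordhaus-Gaddum inequality is sharp, then `χ(G) = a + 1`. -/
theorem chromaticNumber_eq_of_not_colorable {a b : ℕ} (h : ¬ G.Colorable a)
    (h' : ¬ Gᶜ.Colorable b) (hab : a + b + 1 = Fintype.card V) : G.chromaticNumber = (a + 1 : ℕ) := by
  classical
  have : Nonempty V := Fintype.card_pos_iff.1 (by omega)
  obtain ⟨p, hp, hp'⟩ := exists_chromaticNumber_eq G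
  rw [hp]
  have h1 : ¬ p < a := fun k => h (chromaticNumber_le_iff_colorable.1
    (by rw [hp, Nat.cast_le]; omega))
  have := add_lt_card_of_not_colorableOn (colorableOn_univ.not.2 hp') (colorableOn_univ.not.2 h')
  rw [card_univ] at this
  rw [show p = a by omega]

theorem isNGGraph_iff : IsNGGraph G ↔
    ∃ a b, ¬ G.Colorable a ∧ ¬ Gᶜ.Colorable b ∧ a + b + 1 = Fintype.card V := by
  constructor
  · intro h
    rcases isEmpty_or_nonempty V with hV | hV
    · rw [IsNGGraph, chromaticNumber_eq_zero_of_isEmpty, chromaticNumber_eq_zero_of_isEmpty,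
        Fintype.card_eq_zero] at h
      simp at h
    · obtain ⟨a, ha, ha'⟩ := exists_chromaticNumber_eq G
      obtain ⟨b, hb, hb'⟩ := exists_chromaticNumber_eq Gᶜ
      refine ⟨a, b, ha', hb', ?_⟩
      rw [IsNGGraph, ha, hb] at h
      norm_cast at h
      omega
  · rintro ⟨a, b, h, h', hab⟩
    rw [IsNGGraph, chromaticNumber_eq_of_not_colorable h h' hab,
      chromaticNumber_eq_of_not_colorable h' (by rwa [compl_compl]) (by omega)]
    norm_cast
    omega

end NGGraph

end SimpleGraph

/-! ### Equivalence of sharpness and the degree conditions -/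

section Conditions

open Finset SimpleGraph

variable {V : Type*} [Fintype V] [DecidableEq V] {G : SimpleGraph V} [DecidableRel G.Adj] {a b : ℕ}

/-- Otherwise the vertices of larger degree get private colours, the vertices of degree `a` the
remaining ones, and the rest is coloured greedily. The first alternative guards the truncated
subtraction. -/
theorem card_lt_or_not_colorableOn_degree_eq (h : ¬ G.Colorable a) :
    a < #{v | a < G.degree v} ∨
      ¬ G.ColorableOn {v | G.degree v = a} (a - #{v | a < G.degree v}) := by
  by_contra! k
  have := k.2.union (colorableOn_of_card_le le_rfl) (T := {v | a < G.degree v})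
  rw [Nat.sub_add_cancel k.1] at this
  refine h (colorable_of_colorableOn_le_degree (this.mono_left fun v => ?_))
  simp only [mem_filter, mem_univ, true_and, mem_union]
  omega

theorem ABCConditions.of_not_colorable (h : ¬ G.Colorable a) (h' : ¬ Gᶜ.Colorable b)
    (hab : a + b + 1 = Fintype.card V) : ABCConditions G (a + 1) := by
  have hG : ¬ Gᶜᶜ.Colorable a := by rwa [compl_compl]
  have hdc : ∀ v, Gᶜ.degree v = Fintype.card V - 1 - G.degree v := fun v => G.degree_compl v
  have hlt : ∀ v, G.degree v < Fintype.card V := fun v => G.degree_lt_card_verts v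
  have hadj : ∀ u v, u ≠ v → a ≤ G.degree u → a < G.degree v → G.Adj u v := fun u v huv hu hv =>
    adj_of_le_degree h h' hab huv hu hv
  have hnadj : ∀ u v, G.degree u ≤ a → G.degree v < a → ¬ G.Adj u v := by
    intro u v hu hv huv
    have := hlt u
    have := hlt v
    have k := adj_of_le_degree h' hG (by omega) huv.ne (by rw [hdc]; omega) (by rw [hdc]; omega)
    rw [compl_adj] at k
    exact k.2 huv
  set A : Finset V := {v | G.degree v = a} with hA
  set B : Finset V := {v | a < G.degree v} with hB
  set C : Finset V := {v | G.degree v < a} with hC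
  have mA : ∀ v, v ∈ A ↔ G.degree v = a := by simp [A]
  have mB : ∀ v, v ∈ B ↔ a < G.degree v := by simp [B]
  have mC : ∀ v, v ∈ C ↔ G.degree v < a := by simp [C]
  have sA : ∀ v, v ∈ A ↔ v ∈ classA G (a + 1) := by simp [mA, classA]
  have sB : ∀ v, v ∈ B ↔ v ∈ classB G (a + 1) := by simp [mB, classB]
  have hcA : (classA G (a + 1)).ncard = #A := by
    rw [← Set.ncard_coe_finset]; congr 1; ext v; simp [sA]
  have hcB : (classB G (a + 1)).ncard = #B := by
    rw [← Set.ncard_coe_finset]; congr 1; ext v; simp [sB]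
  have eA : ({v | Gᶜ.degree v = b} : Finset V) = A := by
    ext v; have := hlt v
    simp only [mem_filter, mem_univ, true_and, mA, hdc]; omega
  have eC : ({v | b < Gᶜ.degree v} : Finset V) = C := by
    ext v; have := hlt v
    simp only [mem_filter, mem_univ, true_and, mC, hdc]; omega
  have hcard : #A + #B + #C = Fintype.card V := by
    rw [← card_union_of_disjoint, ← card_union_of_disjoint, ← card_univ]
    · congr 1; ext v
      simp only [mem_union, mA, mB, mC, mem_univ, iff_true]; omega
    · rw [Finset.disjoint_left]; intro v; simp only [mem_union, mA, mB, mC]; omega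
    · rw [Finset.disjoint_left]; intro v; simp only [mA, mB]; omega
  have k1 := card_lt_or_not_colorableOn_degree_eq h
  have k2 := card_lt_or_not_colorableOn_degree_eq h'
  rw [← hA, ← hB] at k1
  rw [eA, eC] at k2
  -- If `A` is empty, then `a < #B` and `b < #C`, so there are at least `a + b + 2` vertices.
  have hne : A.Nonempty := by
    rw [nonempty_iff_ne_empty]
    intro e
    rw [e] at k1 k2 hcard
    rw [card_empty] at hcard
    have k1 := k1.resolve_right (not_not.2 (colorableOn_of_card_le (by simp)))
    have k2 := k2.resolve_right (not_not.2 (colorableOn_of_card_le (by simp)))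
    omega
  -- A vertex of `A` sees all of `B` and none of `C`, which makes `G[A]` regular.
  have hdeg : ∀ v ∈ A, #B + #{u ∈ A | G.Adj v u} = a := by
    intro v hv
    refine Eq.trans ?_ ((mA v).1 hv)
    rw [← card_neighborFinset_eq_degree, ← card_union_of_disjoint]
    · congr 1
      ext u
      simp only [mem_union, mem_filter, mem_neighborFinset, mB]
      rw [mA] at hv
      constructor
      · rintro (k | k)
        · exact hadj v u (by rintro rfl; omega) hv.ge (by omega)
        · exact k.2
      · intro k
        by_contra! hu
        have h1 : G.degree u ≠ a := fun e => hu.2 (by rw [mA]; exact e) k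
        exact hnadj v u hv.le (by omega) k
    · rw [Finset.disjoint_left]; intro u
      simp only [mem_filter, mA, mB]; omega
  obtain ⟨o, ho⟩ := hne
  have hBa : #B ≤ a := by have := hdeg o ho; omega
  obtain ⟨d, hda⟩ := Nat.exists_eq_add_of_le hBa
  have hdA : ∀ v ∈ A, #{u ∈ A | G.Adj v u} = d := fun v hv => by have := hdeg v hv; omega
  have hdlt : d < #A := by
    rw [← hdA o ho]
    refine card_lt_card (filter_ssubset.2 ⟨o, ho, G.irrefl⟩)
  have k1 := k1.resolve_left (by omega)
  have k2 := k2.resolve_left (by omega)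
  set s := classA G (a + 1) with hs
  have : Fintype s := Fintype.subtype A sA
  have hcs : Fintype.card s = #A := Fintype.card_of_subtype A sA
  have hreg := regular_of_not_colorable (G := G.induce s) (d := d)
    (fun v => by rw [degree_induce_eq_card_filter sA]; exact hdA v ((sA v).2 v.2))
    (by rwa [hcs])
    (fun k => k1 (by rw [show a - #B = d by omega]; exact colorableOn_induce sA k))
    (fun k => k2 (by
      rw [hcs, show #A - 1 - d = b - #C by omega] at k
      refine colorableOn_induce sA (k.mono_left ?_)
      intro u v huv
      rw [compl_adj]
      exact ⟨fun e => huv.ne e, fun e => huv.2 e⟩))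
  rw [hcs] at hreg
  refine ⟨⟨o, (sA o).1 ho⟩, ?_, ?_, ?_, ?_, ?_⟩
  · rw [hcA, hcB]
    rcases hreg with hreg | hreg | hreg
    · refine Or.inr (Or.inl ⟨fun u hu v hv _ huv => ?_, by omega⟩)
      have := card_eq_zero.1 ((hdA u ((sA u).2 hu)).trans hreg)
      have hv' : v ∈ ({v ∈ A | G.Adj u v} : Finset V) := mem_filter.2 ⟨(sA v).2 hv, huv⟩
      simp [this] at hv'
    · refine Or.inl ⟨fun u hu v hv huv => ?_, by omega⟩
      have hsub : ({w ∈ A | G.Adj u w} : Finset V) ⊆ A.erase u := by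
        intro w hw
        rw [mem_filter] at hw
        exact mem_erase.2 ⟨hw.2.ne', hw.1⟩
      have heq := eq_of_subset_of_card_le hsub (by
        rw [hdA u ((sA u).2 hu), card_erase_of_mem ((sA u).2 hu)]; omega)
      have hv' : v ∈ A.erase u := mem_erase.2 ⟨huv.symm, (sA v).2 hv⟩
      rw [← heq, mem_filter] at hv'
      exact hv'.2
    · refine Or.inr (Or.inr ⟨(nonempty_induce_iso_cycleGraph_five_iff sA).2
        ⟨hreg.2, fun v hv => ?_⟩, by omega⟩)
      rw [hdA v hv, hreg.1]
  · intro u hu v hv huv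
    have := (mB u).1 ((sB u).2 hu)
    exact hadj u v huv this.le ((mB v).1 ((sB v).2 hv))
  · intro u hu v hv huv
    exact hnadj u v (by simp only [classC, Set.mem_ofPred_eq] at hu; omega)
      (by simp only [classC, Set.mem_ofPred_eq] at hv; omega)
  · intro u hu v hv
    have h1 := (mA u).1 ((sA u).2 hu)
    have h2 := (mB v).1 ((sB v).2 hv)
    exact hadj u v (by rintro rfl; omega) h1.ge h2
  · intro u hu v hv
    exact hnadj u v ((mA u).1 ((sA u).2 hu)).le
      (by simp only [classC, Set.mem_ofPred_eq] at hv; omega)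

/-! ### From the degree conditions back to sharpness -/

namespace ABCConditions

variable {k : ℕ}

omit [DecidableEq V] in
theorem one_le (h : ABCConditions G k) : 1 ≤ k := by
  obtain ⟨v, hv⟩ := h.nonempty
  simp only [classA, Set.mem_ofPred_eq] at hv
  omega

omit [DecidableEq V] in
theorem le_card (h : ABCConditions G k) : k ≤ Fintype.card V := by
  obtain ⟨v, hv⟩ := h.nonempty
  simp only [classA, Set.mem_ofPred_eq] at hv
  have := G.degree_lt_card_verts v
  omega

omit [DecidableEq V] in
theorem ncard_add_ncard_add_ncard (G : SimpleGraph V) [DecidableRel G.Adj] (k : ℕ) :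
    (classA G k).ncard + (classB G k).ncard + (classC G k).ncard = Fintype.card V := by
  rw [← Set.ncard_union_eq, ← Set.ncard_union_eq, ← Nat.card_eq_fintype_card, ← Set.ncard_univ]
  · congr 1; ext v
    simp only [classA, classB, classC, Set.mem_union, Set.mem_ofPred_eq, Set.mem_univ, iff_true]
    omega
  · rw [Set.disjoint_left]; intro v
    simp only [classA, classB, classC, Set.mem_union, Set.mem_ofPred_eq]; omega
  · rw [Set.disjoint_left]; intro v
    simp only [classA, classB, Set.mem_ofPred_eq]; omega

/-- Complementation fixes `A`, swaps `B` with `C`, swaps the complete and independent forms of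
`G[A]`, and preserves the 5-cycle. The cardinality equations match because the three classes
partition the vertices. -/
theorem compl (h : ABCConditions G k) : ABCConditions Gᶜ (Fintype.card V + 1 - k) := by
  have hk := h.one_le
  have hk' := h.le_card
  have hsum := ncard_add_ncard_add_ncard G k
  have hd : ∀ v, Gᶜ.degree v + G.degree v + 1 = Fintype.card V := fun v => by
    have := G.degree_lt_card_verts v
    rw [degree_compl]; omega
  have eA : classA Gᶜ (Fintype.card V + 1 - k) = classA G k := by
    ext v; have := hd v
    simp only [classA, Set.mem_ofPred_eq]; omega
  have eB : classB Gᶜ (Fintype.card V + 1 - k) = classC G k := by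
    ext v; have := hd v
    simp only [classB, classC, Set.mem_ofPred_eq]; omega
  have eC : classC Gᶜ (Fintype.card V + 1 - k) = classB G k := by
    ext v; have := hd v
    simp only [classB, classC, Set.mem_ofPred_eq]; omega
  constructor
  all_goals first | rw [eA, eB] | rw [eA, eC] | rw [eA] | rw [eB] | rw [eC]
  · exact h.nonempty
  · rcases h.form with ⟨h1, h2⟩ | ⟨h1, h2⟩ | ⟨⟨e⟩, h2⟩
    · exact Or.inr (Or.inl ⟨by simpa using h1, by omega⟩)
    · exact Or.inl ⟨by simpa using h1, by omega⟩
    · have h5 : (classA G k).ncard = 5 := by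
        rw [← Nat.card_coe_set_eq, Nat.card_congr e.toEquiv, Nat.card_fin]
      refine Or.inr (Or.inr ⟨?_, by omega⟩)
      obtain ⟨e'⟩ := nonempty_iso_cycleGraph_five (G := (cycleGraph 5)ᶜ) (by simp) (by decide)
      refine ⟨RelIso.trans ⟨e.toEquiv, fun {u v} => ?_⟩ e'⟩
      have := e.map_rel_iff' (a := u) (b := v)
      simp only [compl_adj, this]
      simp [Subtype.ext_iff]
  · simpa using h.indepC
  · simpa using h.cliqueB
  · intro u hu v hv
    rw [compl_adj]
    exact ⟨fun e => by subst e; simp only [classA, classC, Set.mem_ofPred_eq] at hu hv; omega,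
      h.nonadjAC u hu v hv⟩
  · intro u hu v hv huv
    exact ((compl_adj ..).1 huv).2 (h.adjAB u hu v hv)

/-- The first two forms give a clique of size `k`, namely `A ∪ B` or `B` with one vertex of `A`. In
the third, a colouring spends `k - 3` colours on the clique `B`, leaving only two for the 5-cycle.
-/
theorem not_colorable (h : ABCConditions G k) : ¬ G.Colorable (k - 1) := by
  have hk := h.one_le
  rintro ⟨c⟩
  obtain ⟨o, ho⟩ := h.nonempty
  have hclique : ∀ s : Set V, G.IsClique s → s.ncard < k := by
    intro s hs
    have := IsClique.card_le_of_coloring (s := s.toFinite.toFinset) (by simpa using hs) c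
    rw [Fintype.card_fin, ← Set.ncard_eq_toFinset_card] at this
    omega
  have hdisj : ∀ v ∈ classA G k, v ∉ classB G k := by
    intro v; simp only [classA, classB, Set.mem_ofPred_eq]; omega
  rcases h.form with ⟨h1, h2⟩ | ⟨h1, h2⟩ | ⟨⟨e⟩, h2⟩
  · have := hclique (classA G k ∪ classB G k) (by
      rintro u (hu | hu) v (hv | hv) huv
      · exact h1 hu hv huv
      · exact h.adjAB u hu v hv
      · exact (h.adjAB v hv u hu).symm
      · exact h.cliqueB hu hv huv)
    rw [Set.ncard_union_eq (Set.disjoint_left.2 hdisj)] at this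
    omega
  · have := hclique (insert o (classB G k)) (by
      rintro u (rfl | hu) v (rfl | hv) huv
      · exact absurd rfl huv
      · exact h.adjAB u ho v hv
      · exact (h.adjAB v ho u hu).symm
      · exact h.cliqueB hu hv huv)
    rw [Set.ncard_insert_of_notMem (hdisj o ho)] at this
    omega
  · set S : Set (Fin (k - 1)) := c '' classB G k with hS
    have hSc : S.ncard = (classB G k).ncard := Set.InjOn.ncard_image fun u hu v hv huv => by
      by_contra hne
      exact c.valid (h.cliqueB hu hv hne) huv
    have c' : (G.induce (classA G k)).Coloring (Sᶜ : Set (Fin (k - 1))) :=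
      Coloring.mk (fun v => ⟨c v, by
        rintro ⟨w, hw, e⟩
        exact c.valid (h.adjAB v v.2 w hw) e.symm⟩) fun {u v} huv e =>
          c.valid (v := u.1) (w := v.1) huv (congrArg Subtype.val e)
    have hcol : (G.induce (classA G k)).Colorable 2 := by
      classical
      refine (c'.colorable).mono ?_
      have := Set.ncard_add_ncard_compl S
      rw [Nat.card_eq_fintype_card, Fintype.card_fin] at this
      rw [← Nat.card_eq_fintype_card, Nat.card_coe_set_eq]
      omega
    have := chromaticNumber_le_iff_colorable.2 (hcol.of_hom e.symm.toHom)
    rw [chromaticNumber_cycleGraph_of_odd 5 (by norm_num) (by decide)] at this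
    norm_cast at this

theorem exists_not_colorable (h : ABCConditions G k) : ∃ a b, a + 1 = k ∧ ¬ G.Colorable a ∧
    ¬ Gᶜ.Colorable b ∧ a + b + 1 = Fintype.card V := by
  have := h.one_le
  have := h.le_card
  exact ⟨k - 1, _, by omega, h.not_colorable, h.compl.not_colorable, by omega⟩

/-- The conditions determine the chromatic number. -/
theorem chromaticNumber_eq (h : ABCConditions G k) : G.chromaticNumber = k := by
  obtain ⟨a, b, rfl, h1, h2, h3⟩ := h.exists_not_colorable
  exact chromaticNumber_eq_of_not_colorable h1 h2 h3

end ABCConditions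

/-- NG-graphs are characterized by the degree conditions. -/
theorem isNGGraph_iff_exists_abcConditions : IsNGGraph G ↔ ∃ k, ABCConditions G k := by
  rw [isNGGraph_iff]
  constructor
  · rintro ⟨a, b, h1, h2, h3⟩
    exact ⟨a + 1, .of_not_colorable h1 h2 h3⟩
  · rintro ⟨k, h⟩
    obtain ⟨a, b, -, h1, h2, h3⟩ := h.exists_not_colorable
    exact ⟨a, b, h1, h2, h3⟩

end Conditions

/-! ### Correctness of programs -/

namespace RAM

variable {R : Type}

@[simp] theorem reg_setMem (s : State R) (i a : ℕ) : (s.setMem i a).reg = s.reg := rfl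

/-- The states have the same memory and agree in all registers outside `X`. -/
structure AgreeOff (X : List R) (s s' : State R) : Prop where
  mem : s.mem = s'.mem
  reg : ∀ z, z ∉ X → s.reg z = s'.reg z

namespace AgreeOff

variable {X Y : List R} {s s' s'' : State R}

theorem refl (X : List R) (s : State R) : AgreeOff X s s := ⟨rfl, fun _ _ => rfl⟩

theorem trans (h : AgreeOff X s s') (h' : AgreeOff X s' s'') : AgreeOff X s s'' :=
  ⟨h.mem.trans h'.mem, fun z hz => (h.reg z hz).trans (h'.reg z hz)⟩

theorem mono (h : AgreeOff X s s') (hXY : X ⊆ Y) : AgreeOff Y s s' :=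
  ⟨h.mem, fun z hz => h.reg z fun k => hz (hXY k)⟩

end AgreeOff

/-- The register `y` contains the truth value of `P`. -/
def Flag (y : R) (P : Prop) (s : State R) : Prop := s.reg y = 1 ∧ P ∨ s.reg y = 0 ∧ ¬ P

theorem Flag.congr {y : R} {P P' : Prop} {s s' : State R} (h : Flag y P s)
    (hs : s'.reg y = s.reg y) (hP : P ↔ P') : Flag y P' s' := by
  rw [Flag, hs, ← hP]
  exact h

theorem Flag.eq_one_iff {y : R} {P : Prop} {s : State R} (h : Flag y P s) :
    s.reg y = 1 ↔ P := by
  rcases h with ⟨h, h'⟩ | ⟨h, h'⟩ <;> simp [h, h']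

theorem Flag.eq_zero_iff {y : R} {P : Prop} {s : State R} (h : Flag y P s) :
    s.reg y = 0 ↔ ¬ P := by
  rcases h with ⟨h, h'⟩ | ⟨h, h'⟩ <;> simp [h, h']

variable [DecidableEq R] {M : ℕ → ℕ → ℕ}

/-- The program `p` halts when started in `s`, and `Q` holds for the number of steps and the final
state. -/
def Terminates (M : ℕ → ℕ → ℕ) (p : Cmd R) (s : State R) (Q : ℕ → State R → Prop) : Prop :=
  ∃ t s', Exec M p s t s' ∧ Q t s'

section Rules

variable {s : State R} {Q Q' : ℕ → State R → Prop} {p q : Cmd R} {c : Cond R}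

theorem Terminates.mono (h : Terminates M p s Q) (hQ : ∀ t s', Q t s' → Q' t s') :
    Terminates M p s Q' := by
  obtain ⟨t, s', h, h'⟩ := h
  exact ⟨t, s', h, hQ t s' h'⟩

theorem terminates_skip : Terminates M .skip s Q ↔ Q 1 s :=
  ⟨fun ⟨_, _, h, hQ⟩ => by cases h; exact hQ, fun hQ => ⟨_, _, .skip s, hQ⟩⟩

theorem terminates_set {x : R} {a : Operand R} :
    Terminates M (.set x a) s Q ↔ Q 1 (s.setReg x (a.val s)) :=
  ⟨fun ⟨_, _, h, hQ⟩ => by cases h; exact hQ, fun hQ => ⟨_, _, .set s x a, hQ⟩⟩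

theorem terminates_inc {x : R} : Terminates M (.inc x) s Q ↔ Q 1 (s.setReg x (s.reg x + 1)) :=
  ⟨fun ⟨_, _, h, hQ⟩ => by cases h; exact hQ, fun hQ => ⟨_, _, .inc s x, hQ⟩⟩

theorem terminates_load {x : R} {a : Operand R} :
    Terminates M (.load x a) s Q ↔ Q 1 (s.setReg x (s.mem (a.val s))) :=
  ⟨fun ⟨_, _, h, hQ⟩ => by cases h; exact hQ, fun hQ => ⟨_, _, .load s x a, hQ⟩⟩

theorem terminates_store {a b : Operand R} :
    Terminates M (.store a b) s Q ↔ Q 1 (s.setMem (a.val s) (b.val s)) :=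
  ⟨fun ⟨_, _, h, hQ⟩ => by cases h; exact hQ, fun hQ => ⟨_, _, .store s a b, hQ⟩⟩

theorem terminates_query {x : R} {a b : Operand R} :
    Terminates M (.query x a b) s Q ↔ Q 1 (s.setReg x (M (a.val s) (b.val s))) :=
  ⟨fun ⟨_, _, h, hQ⟩ => by cases h; exact hQ, fun hQ => ⟨_, _, .query s x a b, hQ⟩⟩

/-- This and its companions are weakest-precondition equations: rewriting with them executes a
program symbolically, with the step count threaded through the postcondition. -/
theorem terminates_seq : Terminates M (.seq p q) s Q ↔
    Terminates M p s fun t s' => Terminates M q s' fun t' s'' => Q (t + t') s'' :=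
  ⟨fun ⟨_, _, h, hQ⟩ => by cases h with | seq h h' => exact ⟨_, _, h, _, _, h', hQ⟩,
    fun ⟨_, _, h, _, _, h', hQ⟩ => ⟨_, _, .seq h h', hQ⟩⟩

theorem terminates_ite : Terminates M (.ite c p q) s Q ↔
    (c.Holds s → Terminates M p s fun t s' => Q (t + 1) s') ∧
      (¬ c.Holds s → Terminates M q s fun t s' => Q (t + 1) s') := by
  constructor
  · rintro ⟨t, s', h, hQ⟩
    cases h with
    | ite_true hc h => exact ⟨fun _ => ⟨_, _, h, hQ⟩, fun k => absurd hc k⟩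
    | ite_false hc h => exact ⟨fun k => absurd k hc, fun _ => ⟨_, _, h, hQ⟩⟩
  · rintro ⟨h, h'⟩
    by_cases hc : c.Holds s
    · obtain ⟨t, s', h, hQ⟩ := h hc
      exact ⟨_, _, .ite_true hc h, hQ⟩
    · obtain ⟨t, s', h, hQ⟩ := h' hc
      exact ⟨_, _, .ite_false hc h, hQ⟩

theorem terminates_loop : Terminates M (.loop c p) s Q ↔
    (c.Holds s → Terminates M p s fun t s' => Terminates M (.loop c p) s' fun t' s'' =>
      Q (t + t' + 1) s'') ∧ (¬ c.Holds s → Q 1 s) := by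
  constructor
  · rintro ⟨t, s', h, hQ⟩
    cases h with
    | loop_true hc h h' => exact ⟨fun _ => ⟨_, _, h, _, _, h', hQ⟩, fun k => absurd hc k⟩
    | loop_false hc => exact ⟨fun k => absurd k hc, fun _ => hQ⟩
  · rintro ⟨h, h'⟩
    by_cases hc : c.Holds s
    · obtain ⟨t, s', h, t', s'', h', hQ⟩ := h hc
      exact ⟨_, _, .loop_true hc h h', hQ⟩
    · exact ⟨_, _, .loop_false hc, h' hc⟩

end Rules

@[simp] theorem reg_setReg (s : State R) (x y : R) (a : ℕ) :
    (s.setReg x a).reg y = if y = x then a else s.reg y := Function.update_apply ..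

@[simp] theorem mem_setReg (s : State R) (x : R) (a : ℕ) : (s.setReg x a).mem = s.mem := rfl

theorem AgreeOff.setReg {X : List R} {s s' : State R} (h : AgreeOff X s s') {y : R} (hy : y ∈ X) (a : ℕ) : AgreeOff X (s.setReg y a) s' :=
  ⟨h.mem, fun z hz => by
    rw [reg_setReg, if_neg (by rintro rfl; exact hz hy)]
    exact h.reg z hz⟩

end RAM

/-! ### Invariants and step bounds for the subprograms -/

namespace AlgorithmNG

open RAM

variable {M : ℕ → ℕ → ℕ} {s : State Var} {Q : ℕ → State Var → Prop} {n : ℕ}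

/-- A loop over the vertices preserves an invariant `I`. -/
theorem terminates_forVertices {y : Var} {p : Cmd Var} (T : ℕ) (I : ℕ → State Var → Prop)
    (hn : s.reg .n = n) (hy : y ≠ .n) (h0 : I 0 (s.setReg y 0))
    (hp : ∀ i < n, ∀ s : State Var, s.reg .n = n → s.reg y = i → I i s →
      Terminates M p s fun t s' => t ≤ T ∧ s'.reg .n = n ∧ s'.reg y = i ∧
        I (i + 1) (s'.setReg y (i + 1)))
    (hQ : ∀ t s', t ≤ n * (T + 2) + 2 → s'.reg .n = n → I n s' → Q t s') :
    Terminates M (forVertices y p) s Q := by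
  -- Induction on the number `j` of remaining iterations. Each costs at most `T` steps plus the test
  -- and the increment; the last, failing test accounts for the `+ 1`.
  have loop : ∀ j i, i + j = n → ∀ s : State Var, s.reg .n = n → s.reg y = i → I i s →
      Terminates M (.loop (.lt (.reg y) (.reg .n)) (block [p, .inc y])) s fun t s' =>
        t ≤ j * (T + 2) + 1 ∧ s'.reg .n = n ∧ I n s' := by
    intro j
    induction j with
    | zero =>
      intro i hi s hn hy hI
      rw [terminates_loop]
      simp only [Cond.Holds, Operand.val, hn, hy]
      obtain rfl : i = n := hi
      exact ⟨fun h => absurd h (lt_irrefl _), fun _ => ⟨by omega, trivial, hI⟩⟩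
    | succ j ih =>
      intro i hi s hn' hy' hI
      rw [terminates_loop]
      simp only [Cond.Holds, Operand.val, hn', hy', block, terminates_seq, terminates_inc]
      refine ⟨fun h => (hp i h s hn' hy' hI).mono ?_, fun h => absurd (show i < n by omega) h⟩
      rintro t s' ⟨ht, h1, h2, h3⟩
      rw [h2]
      refine (ih (i + 1) (by omega) _ (by rwa [reg_setReg, if_neg hy.symm])
        (by rw [reg_setReg, if_pos rfl]) h3).mono ?_
      rintro t' s'' ⟨ht', h4, h5⟩
      refine ⟨?_, h4, h5⟩
      rw [Nat.succ_mul]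
      omega
  rw [forVertices, block, block, terminates_seq, terminates_set]
  refine (loop n 0 (zero_add n) _ (by rwa [reg_setReg, if_neg hy.symm])
    (by rw [reg_setReg, if_pos rfl]) h0).mono ?_
  rintro t s' ⟨ht, h1, h2⟩
  exact hQ _ _ (by omega) h1 h2

theorem terminates_addCard (c : ℕ) (hn : s.reg .n = n)
    (hQ : ∀ t s', t ≤ 5 * n + 2 → AgreeOff [.u, .cu, .x] s' s →
      s'.reg .x = s.reg .x + Nat.count (s.mem · = c) n → Q t s') :
    Terminates M (addCard c) s Q := by
  refine terminates_forVertices 3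
    (fun i s' => AgreeOff [.u, .cu, .x] s' s ∧ s'.reg .x = s.reg .x + Nat.count (s.mem · = c) i)
    hn (by decide) ⟨(AgreeOff.refl _ _).setReg (by decide) _, by simp⟩ ?_
    fun t s' ht _ hI => hQ t s' (by omega) hI.1 hI.2
  intro i hi s' hn' hu ⟨hA, hx⟩
  simp only [block, whenEq, terminates_seq, terminates_load, terminates_ite, terminates_inc,
    terminates_skip, Cond.Holds, Operand.val, reg_setReg, if_true, Nat.count_succ]
  constructor <;> intro h
  · refine ⟨by omega, by simpa using hn', by simpa using hu, ?_, ?_⟩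
    · exact ((hA.setReg (by decide) _).setReg (by decide) _).setReg (by decide) _
    · rw [hu, hA.mem] at h
      simp [hx, h, add_assoc]
  · refine ⟨by omega, by simpa using hn', by simpa using hu, ?_, ?_⟩
    · exact (hA.setReg (by decide) _).setReg (by decide) _
    · rw [hu, hA.mem] at h
      simp [hx, h]

/-- The pair `u, v` is not a reason for `testPairs` to fail. -/
def NoPair (M : ℕ → ℕ → ℕ) (m : ℕ → ℕ) (c c' bad u v : ℕ) : Prop :=
  m u = c → m v = c' → u ≠ v → M u v ≠ bad

theorem terminates_testPairs (c c' bad : ℕ) {y : Var} (hy : y ∉ [.u, .v, .cu, .cv, .e, .n])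
    (hn : s.reg .n = n)
    (hQ : ∀ t s', t ≤ 10 * (n * n) + 4 * n + 3 → AgreeOff [.u, .v, .cu, .cv, .e, y] s' s →
      Flag y (∀ u < n, ∀ v < n, NoPair M s.mem c c' bad u v) s' → Q t s') :
    Terminates M (testPairs c c' bad y) s Q := by
  simp only [List.mem_cons, List.not_mem_nil, or_false, not_or] at hy
  simp only [← ne_eq] at hy
  obtain ⟨yu, yv, ycu, ycv, ye, yn⟩ := hy
  classical
  set X : List Var := [.u, .v, .cu, .cv, .e, y] with hX
  have mX : ∀ z, z ∈ X ↔ z = .u ∨ z = .v ∨ z = .cu ∨ z = .cv ∨ z = .e ∨ z = y := by simp [X]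
  rw [testPairs, block, block, terminates_seq, terminates_set]
  refine terminates_forVertices (10 * n + 2) (fun i s' => AgreeOff X s' s ∧
    Flag y (∀ u < i, ∀ v < n, NoPair M s.mem c c' bad u v) s')
    (by simpa [yn.symm] using hn) (by decide) ⟨?_, ?_⟩ ?_ ?_
  · exact ((AgreeOff.refl _ _).setReg (by simp [mX]) _).setReg (by simp [mX]) _
  · exact Or.inl ⟨by simp [yu, Operand.val], by simp⟩
  · rintro i hi s' hn' hu ⟨hA, hF⟩
    refine terminates_forVertices 8 (fun j s' => AgreeOff X s' s ∧ s'.reg .u = i ∧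
      Flag y ((∀ u < i, ∀ v < n, NoPair M s.mem c c' bad u v) ∧
        ∀ v < j, NoPair M s.mem c c' bad i v) s') hn' (by decide)
      ⟨hA.setReg (by simp [mX]) _, by simpa using hu, hF.congr (by simp [yv]) (by simp)⟩ ?_ ?_
    · rintro j hj s' hn' hv ⟨hA, hu, hF⟩
      -- One inner iteration keeps the flag or clears it according to the current pair, which
      -- advances the invariant by one.
      have key : ∀ s'' : State Var, s''.reg y = (if NoPair M s.mem c c' bad i j then s'.reg y
          else 0) → Flag y ((∀ u < i, ∀ v < n, NoPair M s.mem c c' bad u v) ∧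
            ∀ v < j + 1, NoPair M s.mem c c' bad i v) s'' := by
        intro s'' h
        simp only [Nat.forall_lt_succ_right, ← and_assoc]
        by_cases k : NoPair M s.mem c c' bad i j
        · exact hF.congr (by rw [h, if_pos k]) (by simp [k])
        · exact Or.inr ⟨by rw [h, if_neg k], fun k' => k k'.2⟩
      have hA' : ∀ a b, AgreeOff X ((s'.setReg .cu a).setReg .cv b) s := fun a b =>
        (hA.setReg (by simp [mX]) _).setReg (by simp [mX]) _
      simp only [block, whenEq, terminates_seq, terminates_load, terminates_ite, terminates_set,
        terminates_query, terminates_skip, Cond.Holds, Operand.val, reg_setReg, mem_setReg, if_true,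
        reduceCtorEq, if_false, hu, hv, hA.mem]
      refine ⟨fun h1 => ⟨fun h2 => ⟨fun h3 => ?_, fun h3 => ⟨fun h4 => ?_, fun h4 => ?_⟩⟩,
        fun h2 => ?_⟩, fun h1 => ?_⟩
      all_goals
        refine ⟨by omega, by simp [yn.symm, *], by simp [yv.symm, *], ?_, by simp [yu.symm, *], key _ ?_⟩
      · exact (hA' _ _).setReg (by simp [mX]) _
      · simp [NoPair, *]
      · exact (((hA' _ _).setReg (by simp [mX]) _).setReg (by simp [mX]) _).setReg (by simp [mX]) _
      · simp [NoPair, *]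
      · exact ((hA' _ _).setReg (by simp [mX]) _).setReg (by simp [mX]) _
      · simp [NoPair, *]
      · exact (hA' _ _).setReg (by simp [mX]) _
      · simp [NoPair, *]
      · exact (hA' _ _).setReg (by simp [mX]) _
      · simp [NoPair, *]
    · rintro t s'' ht hn'' ⟨hA', hu', hF'⟩
      refine ⟨by omega, hn'', hu', hA'.setReg (by simp [mX]) _, hF'.congr (by simp [yu]) ?_⟩
      rw [Nat.forall_lt_succ_right]
  · rintro t s' ht hn' ⟨hA, hF⟩
    refine hQ _ _ ?_ hA hF
    have : n * (10 * n + 2 + 2) = 10 * (n * n) + 4 * n := by ring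
    omega

/-- The number of elements of class `c`. -/
def card (m : ℕ → ℕ) (n c : ℕ) : ℕ := Nat.count (m · = c) n

/-- The number of neighbours of `u` in the class `A`. -/
def degreeA (M : ℕ → ℕ → ℕ) (m : ℕ → ℕ) (u n : ℕ) : ℕ :=
  Nat.count (fun v => m v = clA ∧ M u v = 1) n

theorem terminates_testFiveCycle (hn : s.reg .n = n)
    (hQ : ∀ t s', t ≤ 8 * (n * n) + 15 * n + 10 →
      AgreeOff [.cyc, .x, .u, .cu, .v, .cv, .e, .d] s' s →
      Flag .cyc (card s.mem n clA = 5 ∧ ∀ u < n, s.mem u = clA → degreeA M s.mem u n = 2) s' →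
      Q t s') :
    Terminates M testFiveCycle s Q := by
  set X : List Var := [.cyc, .x, .u, .cu, .v, .cv, .e, .d] with hX
  simp only [testFiveCycle, block]
  rw [terminates_seq, terminates_set, terminates_seq, terminates_set, terminates_seq]
  refine terminates_addCard _ (n := n) (by simpa using hn) fun t1 s1 ht1 hA1 hx1 => ?_
  have hA2 : AgreeOff X s1 s := (hA1.mono (by decide)).trans
    (((AgreeOff.refl _ _).setReg (by decide) _).setReg (by decide) _)
  have hc1 : s1.reg .cyc = 1 := by rw [hA1.reg .cyc (by decide)]; simp [Operand.val]
  simp only [reg_setReg, mem_setReg, Operand.val, if_true, zero_add] at hx1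
  have loop : ∀ s2 : State Var, ∀ t2 ≤ t1 + 5, AgreeOff X s2 s →
      Flag .cyc (card s.mem n clA = 5) s2 → Terminates M (forVertices .u (block [
        .load .cu (.reg .u), whenEq .cu clA (block [.set .d (.lit 0),
        forVertices .v (block [.load .cv (.reg .v),
          whenEq .cv clA (block [.query .e (.reg .u) (.reg .v), whenEq .e 1 (.inc .d)])]),
        .ite (.eq (.reg .d) (.lit 2)) .skip (.set .cyc (.lit 0))])])) s2 fun t s' => Q (t2 + t) s' := by
    intro s2 t2 ht2 hA hF
    refine terminates_forVertices (8 * n + 8) (fun i s' => AgreeOff X s' s ∧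
      Flag .cyc (card s.mem n clA = 5 ∧ ∀ u < i, s.mem u = clA → degreeA M s.mem u n = 2) s')
      (by rw [hA.reg .n (by decide), hn]) (by decide)
      ⟨hA.setReg (by decide) _, hF.congr (by simp) (by simp)⟩ ?_ ?_
    · rintro i hi s' hn' hu ⟨hA, hF⟩
      rw [block, block, terminates_seq, terminates_load, whenEq, terminates_ite]
      simp only [Cond.Holds, Operand.val, reg_setReg, if_true, hu, hA.mem, terminates_skip]
      constructor
      · intro hi'
        simp only [block]
        rw [terminates_seq, terminates_set, terminates_seq]
        refine terminates_forVertices 6 (fun j s'' => AgreeOff X s'' s ∧ s''.reg .u = i ∧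
          s''.reg .cyc = s'.reg .cyc ∧ s''.reg .d = degreeA M s.mem i j) (n := n)
          (by simpa using hn') (by decide) ⟨?_, ?_, ?_, ?_⟩ ?_ ?_
        · exact ((hA.setReg (by decide) _).setReg (by decide) _).setReg (by decide) _
        · simpa using hu
        · simp
        · simp [degreeA, Operand.val]
        · rintro j hj s3 hn3 hv3 ⟨hA3, hu3, hc3, hd3⟩
          simp only [terminates_seq, terminates_load, whenEq, terminates_ite, terminates_query,
            terminates_inc, terminates_skip, Cond.Holds, Operand.val, reg_setReg, if_true, hv3,
            hA3.mem, reduceCtorEq, if_false, hu3, degreeA, Nat.count_succ]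
          have hA4 := fun a => hA3.setReg (y := .cv) (by decide) a
          refine ⟨fun h1 => ⟨fun h2 => ?_, fun h2 => ?_⟩, fun h1 => ?_⟩
          all_goals
            refine ⟨by omega, by simp [*], by simp [*], ?_, by simp [*], by simp [*], ?_⟩
          · exact (((hA4 _).setReg (by decide) _).setReg (by decide) _).setReg (by decide) _
          · simp [hd3, h1, h2, degreeA]
          · exact ((hA4 _).setReg (by decide) _).setReg (by decide) _
          · simp [hd3, h1, h2, degreeA]
          · exact (hA4 _).setReg (by decide) _
          · simp [hd3, h1, degreeA]
        · rintro t3 s3 ht3 hn3 ⟨hA3, hu3, hc3, hd3⟩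
          simp only [terminates_ite, terminates_skip, terminates_set, Cond.Holds, Operand.val, hd3]
          refine ⟨fun h => ⟨by omega, hn3, hu3, hA3.setReg (by decide) _, ?_⟩,
            fun h => ⟨by omega, by simp [hn3], by simp [hu3],
              (hA3.setReg (by decide) _).setReg (by decide) _, ?_⟩⟩
          · refine hF.congr (by simpa using hc3) ?_
            rw [Nat.forall_lt_succ_right]
            simp [h]
          · refine Or.inr ⟨by simp, fun k => h (k.2 i (Nat.lt_succ_self i) hi')⟩
      · intro hi'
        refine ⟨by omega, by simp [hn'], by simp, ?_, ?_⟩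
        · exact (hA.setReg (by decide) _).setReg (by decide) _
        · refine hF.congr (by simp) ?_
          rw [Nat.forall_lt_succ_right]
          simp [hi']
    · rintro t s' ht hn' ⟨hA, hF⟩
      refine hQ _ _ ?_ hA hF
      have : n * (8 * n + 8 + 2) = 8 * (n * n) + 10 * n := by ring
      omega
  rw [terminates_seq, terminates_ite, terminates_skip, terminates_set]
  simp only [Cond.Holds, Operand.val, hx1]
  constructor <;> intro h
  · refine (loop s1 (t1 + 4) (by omega) hA2 (Or.inl ⟨hc1, h⟩)).mono fun t s' h => ?_
    convert h using 1; ring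
  · refine (loop _ (t1 + 4) (by omega) (hA2.setReg (by decide) _)
      (Or.inr ⟨by simp, h⟩)).mono fun t s' h => ?_
    convert h using 1; ring

end AlgorithmNG

/-! ### The rounds and the main loop -/

namespace AlgorithmNG

open RAM

variable {M : ℕ → ℕ → ℕ} {s : State Var} {Q : ℕ → State Var → Prop} {n : ℕ}

/-- The class of a vertex of degree `d - 1`. -/
def classCode (d k : ℕ) : ℕ := if d = k then clA else if k < d then clB else clC

/-- As this subprogram writes to memory, `AgreeOff` is replaced by agreement of registers alone. The
final cell contents do not depend on the previous memory, so rounds do not interfere. -/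
theorem terminates_partition (hn : s.reg .n = n)
    (hQ : ∀ t s', t ≤ 5 * (n * n) + 8 * n + 2 → (∀ z, z ∉ [.v, .u, .e, .d] → s'.reg z = s.reg z) →
      (∀ v < n, s'.mem v = classCode (1 + Nat.count (M v · = 1) n) (s.reg .k)) → Q t s') :
    Terminates M partition s Q := by
  set X : List Var := [.v, .u, .e, .d] with hX
  have ne : ∀ z, z ∉ X → z ≠ .v ∧ z ≠ .u ∧ z ≠ .e ∧ z ≠ .d := by simp [X]
  have set' : ∀ {s' : State Var} {z : Var} {a : ℕ}, z ∈ X → (∀ z, z ∉ X → s'.reg z = s.reg z) →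
      ∀ z', z' ∉ X → (s'.setReg z a).reg z' = s.reg z' := by
    intro s' z a hz h z' hz'
    rw [reg_setReg, if_neg (by rintro rfl; exact hz' hz), h z' hz']
  refine terminates_forVertices (5 * n + 6) (fun i s' => (∀ z, z ∉ X → s'.reg z = s.reg z) ∧
    ∀ v < i, s'.mem v = classCode (1 + Nat.count (M v · = 1) n) (s.reg .k)) hn (by decide)
    ⟨set' (by decide) fun _ _ => rfl, by simp⟩ ?_ ?_
  · rintro i hi s1 hn1 hv1 ⟨hA1, hm1⟩
    simp only [block]
    rw [terminates_seq, terminates_set, terminates_seq]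
    refine terminates_forVertices 3 (fun j s' => (∀ z, z ∉ X → s'.reg z = s.reg z) ∧
      s'.reg .v = i ∧ s'.mem = s1.mem ∧ s'.reg .d = 1 + Nat.count (M i · = 1) j) (n := n)
      (by simp [hn1]) (by decide) ⟨set' (by decide) (set' (by decide) hA1), by simp [hv1], rfl,
        by simp [Operand.val]⟩ ?_ ?_
    · rintro j hj s2 hn2 hu2 ⟨hA2, hv2, hm2, hd2⟩
      simp only [whenEq, terminates_seq, terminates_query, terminates_ite, terminates_inc,
        terminates_skip, Cond.Holds, Operand.val, reg_setReg, if_true, hu2, hv2, reduceCtorEq,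
        if_false, Nat.count_succ]
      refine ⟨fun h => ?_, fun h => ?_⟩
      all_goals refine ⟨by omega, by simp [hn2], by simp, ?_, by simp, hm2, ?_⟩
      · intro z hz
        have := ne z hz
        simp [this, hA2 z hz]
      · simp [hd2, h, add_assoc]
      · intro z hz
        have := ne z hz
        simp [this, hA2 z hz]
      · simp [hd2, h]
    · rintro t s2 ht hn2 ⟨hA2, hv2, hm2, hd2⟩
      simp only [terminates_ite, terminates_store, Cond.Holds, Operand.val, hv2, hd2,
        hA2 .k (by decide)]
      have key : ∀ s' : State Var, s'.mem = Function.update s1.mem i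
          (classCode (1 + Nat.count (M i · = 1) n) (s.reg .k)) → ∀ v < i + 1,
          s'.mem v = classCode (1 + Nat.count (M v · = 1) n) (s.reg .k) := by
        intro s' h v hv
        rw [h]
        rcases (Nat.lt_succ_iff_lt_or_eq.1 hv) with hv | rfl
        · rw [Function.update_of_ne hv.ne, hm1 v hv]
        · rw [Function.update_self]
      refine ⟨fun h => ?_, fun h => ⟨fun h' => ?_, fun h' => ?_⟩⟩
      all_goals
        refine ⟨by omega, by simp [hn2], by simp [hv2], set' (by decide) hA2, key _ ?_⟩
        simp [State.setMem, State.setReg, hm2, classCode, h]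
      · simp [h']
      · simp [h']
  · rintro t s1 ht hn1 ⟨hA1, hm1⟩
    refine hQ _ _ ?_ hA1 hm1
    have : n * (5 * n + 6 + 2) = 5 * (n * n) + 8 * n := by ring
    omega

theorem terminates_question (c c' bad : ℕ) {P : Prop} (hn : s.reg .n = n) (hP : Flag .ok P s)
    (hQ : ∀ t s', t ≤ 10 * (n * n) + 4 * n + 7 → AgreeOff [.u, .v, .cu, .cv, .e, .r, .ok] s' s →
      Flag .ok (P ∧ ∀ u < n, ∀ v < n, NoPair M s.mem c c' bad u v) s' → Q t s') :
    Terminates M (question c c' bad) s Q := by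
  simp only [question, whenEq, block]
  rw [terminates_ite, terminates_seq, terminates_skip]
  simp only [Cond.Holds, Operand.val, hP.eq_one_iff]
  refine ⟨fun h => ?_, fun h => ?_⟩
  · refine terminates_testPairs _ _ _ (by decide) hn fun t s' ht hA hF => ?_
    rw [terminates_ite, terminates_set, terminates_skip]
    simp only [Cond.Holds, Operand.val, hF.eq_zero_iff]
    have hA' : AgreeOff [.u, .v, .cu, .cv, .e, .r, .ok] s' s := hA.mono (by decide)
    refine ⟨fun k => ?_, fun k => ?_⟩
    · exact hQ _ _ (by omega) (hA'.setReg (by decide) _) (Or.inr ⟨by simp, fun k' => k k'.2⟩)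
    · exact hQ _ _ (by omega) hA' (hP.congr (hA.reg _ (by decide)) (by simpa [h] using k))
  · exact hQ _ _ (by omega) (AgreeOff.refl _ _) (hP.congr rfl (by simp [h]))

/-- `G[A]` is complete. -/
def ComplA (M : ℕ → ℕ → ℕ) (m : ℕ → ℕ) (n : ℕ) : Prop :=
  ∀ u < n, ∀ v < n, NoPair M m clA clA 0 u v

/-- `G[A]` is independent. -/
def IndepA (M : ℕ → ℕ → ℕ) (m : ℕ → ℕ) (n : ℕ) : Prop :=
  ∀ u < n, ∀ v < n, NoPair M m clA clA 1 u v

/-- `G[A]` is a 5-cycle. -/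
def CycleA (M : ℕ → ℕ → ℕ) (m : ℕ → ℕ) (n : ℕ) : Prop :=
  card m n clA = 5 ∧ ∀ u < n, m u = clA → degreeA M m u n = 2

theorem terminates_questionI (hn : s.reg .n = n)
    (hQ : ∀ t s', t ≤ 28 * (n * n) + 28 * n + 40 →
      AgreeOff [.ok, .compl, .indep, .cyc, .x, .u, .cu, .v, .cv, .e, .d] s' s →
      Flag .compl (ComplA M s.mem n) s' → Flag .indep (IndepA M s.mem n) s' →
      Flag .cyc (CycleA M s.mem n) s' →
      Flag .ok ((ComplA M s.mem n ∨ IndepA M s.mem n ∨ CycleA M s.mem n) ∧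
        card s.mem n clA ≠ 0) s' → Q t s') :
    Terminates M questionI s Q := by
  set X : List Var := [.ok, .compl, .indep, .cyc, .x, .u, .cu, .v, .cv, .e, .d] with hX
  have when1 : ∀ {y : Var} {P P' : Prop} {s' : State Var} {Q : ℕ → State Var → Prop},
      Flag .ok P s' → Flag y P' s' → (∀ s'', AgreeOff [.ok] s'' s' → Flag .ok (P ∨ P') s'' →
        Q 2 s'') → Terminates M (whenEq y 1 (.set .ok (.lit 1))) s' Q := by
    intro y P P' s' Q hP hP' hQ
    rw [whenEq, terminates_ite, terminates_skip, terminates_set]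
    simp only [Cond.Holds, Operand.val, hP'.eq_one_iff]
    exact ⟨fun h => hQ _ ((AgreeOff.refl _ _).setReg (by decide) _)
      (Or.inl ⟨by simp, Or.inr h⟩),
      fun h => hQ _ (AgreeOff.refl _ _) (hP.congr rfl (by simp [h]))⟩
  simp only [questionI, block]
  rw [terminates_seq, terminates_set]
  have hA0 : AgreeOff X (s.setReg .ok 0) s := (AgreeOff.refl _ _).setReg (by decide) _
  have hF0 : Flag .ok False (s.setReg .ok 0) := Or.inr ⟨by simp, id⟩
  rw [terminates_seq]
  refine terminates_testPairs _ _ _ (n := n) (by decide) (by simp [hn]) fun t1 s1 ht1 hA1 hF1 => ?_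
  have hB1 := (hA1.mono (show _ ⊆ X by decide)).trans hA0
  replace hF0 := hF0.congr (hA1.reg .ok (by decide)) Iff.rfl
  rw [terminates_seq]
  refine when1 hF0 hF1 fun s2 hA2 hF2 => ?_
  have hB2 := (hA2.mono (show _ ⊆ X by decide)).trans hB1
  replace hF1 := hF1.congr (hA2.reg .compl (by decide)) Iff.rfl
  rw [terminates_seq]
  refine terminates_testPairs _ _ _ (n := n) (by decide) (by rw [hB2.reg .n (by decide), hn])
    fun t3 s3 ht3 hA3 hF3 => ?_
  have hB3 := (hA3.mono (show _ ⊆ X by decide)).trans hB2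
  replace hF1 := hF1.congr (hA3.reg .compl (by decide)) Iff.rfl
  replace hF2 := hF2.congr (hA3.reg .ok (by decide)) Iff.rfl
  rw [hB2.mem] at hF3
  rw [terminates_seq]
  refine when1 hF2 hF3 fun s4 hA4 hF4 => ?_
  have hB4 := (hA4.mono (show _ ⊆ X by decide)).trans hB3
  replace hF1 := hF1.congr (hA4.reg .compl (by decide)) Iff.rfl
  replace hF3 := hF3.congr (hA4.reg .indep (by decide)) Iff.rfl
  rw [terminates_seq]
  refine terminates_testFiveCycle (n := n) (by rw [hB4.reg .n (by decide), hn])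
    fun t5 s5 ht5 hA5 hF5 => ?_
  have hB5 := (hA5.mono (show _ ⊆ X by decide)).trans hB4
  replace hF1 := hF1.congr (hA5.reg .compl (by decide)) Iff.rfl
  replace hF3 := hF3.congr (hA5.reg .indep (by decide)) Iff.rfl
  replace hF4 := hF4.congr (hA5.reg .ok (by decide)) Iff.rfl
  rw [hB4.mem] at hF5
  rw [terminates_seq]
  refine when1 hF4 hF5 fun s6 hA6 hF6 => ?_
  have hB6 := (hA6.mono (show _ ⊆ X by decide)).trans hB5
  replace hF1 := hF1.congr (hA6.reg .compl (by decide)) Iff.rfl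
  replace hF3 := hF3.congr (hA6.reg .indep (by decide)) Iff.rfl
  replace hF5 := hF5.congr (hA6.reg .cyc (by decide)) Iff.rfl
  rw [terminates_seq, terminates_set, terminates_seq]
  refine terminates_addCard _ (n := n) (by simp [hB6.reg .n (by decide), hn])
    fun t7 s7 ht7 hA7 hx7 => ?_
  have hB7 := (hA7.mono (show _ ⊆ X by decide)).trans (hB6.setReg (y := .x) (by decide) _)
  replace hF1 := hF1.congr ((hA7.reg .compl (by decide)).trans (by simp)) Iff.rfl
  replace hF3 := hF3.congr ((hA7.reg .indep (by decide)).trans (by simp)) Iff.rfl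
  replace hF5 := hF5.congr ((hA7.reg .cyc (by decide)).trans (by simp)) Iff.rfl
  replace hF6 := hF6.congr ((hA7.reg .ok (by decide)).trans (by simp)) Iff.rfl
  simp only [reg_setReg, mem_setReg, Operand.val, if_true, zero_add, hB6.mem] at hx7
  rw [whenEq, terminates_ite, terminates_skip, terminates_set]
  simp only [Cond.Holds, Operand.val, hx7]
  refine ⟨fun h => ?_, fun h => ?_⟩
  · refine hQ _ _ (by omega) (hB7.setReg (by decide) _) (hF1.congr (by simp) Iff.rfl)
      (hF3.congr (by simp) Iff.rfl) (hF5.congr (by simp) Iff.rfl) (Or.inr ⟨by simp, ?_⟩)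
    exact fun k => k.2 h
  · refine hQ _ _ (by omega) hB7 hF1 hF3 hF5 (hF6.congr rfl ?_)
    rw [false_or, or_assoc]
    exact (and_iff_left h).symm

/-- The outcome of step (vi). -/
def CheckVI (M : ℕ → ℕ → ℕ) (m : ℕ → ℕ) (n k : ℕ) : Prop :=
  ComplA M m n ∧ card m n clA + card m n clB = k ∨ IndepA M m n ∧ 1 + card m n clB = k ∨
    CycleA M m n ∧ 3 + card m n clB = k

theorem terminates_stepVI (hn : s.reg .n = n) (hans : s.reg .ans = 0)
    (hF1 : Flag .compl (ComplA M s.mem n) s) (hF2 : Flag .indep (IndepA M s.mem n) s)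
    (hF3 : Flag .cyc (CycleA M s.mem n) s)
    (hQ : ∀ t s', t ≤ 20 * n + 30 → AgreeOff [.ans, .x, .u, .cu] s' s →
      Flag .ans (CheckVI M s.mem n (s.reg .k)) s' → Q t s') :
    Terminates M stepVI s Q := by
  set X : List Var := [.ans, .x, .u, .cu] with hX
  have final : ∀ {P : Prop} {j : ℕ} {s' : State Var} {Q : ℕ → State Var → Prop},
      AgreeOff X s' s → Flag .ans P s' → s'.reg .x = j →
      (∀ s'', AgreeOff X s'' s → Flag .ans (P ∨ j = s.reg .k) s'' → Q 2 s'') →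
      Terminates M (.ite (.eq (.reg .x) (.reg .k)) (.set .ans (.lit 1)) .skip) s' Q := by
    intro P j s' Q hA hP hx hQ
    rw [terminates_ite, terminates_skip, terminates_set]
    simp only [Cond.Holds, Operand.val, hx, hA.reg .k (by decide)]
    exact ⟨fun h => hQ _ (hA.setReg (by decide) _) (Or.inl ⟨by simp, Or.inr h⟩),
      fun h => hQ _ hA (hP.congr rfl (by simp [h]))⟩
  have one : ∀ {P P' : Prop} {y : Var} {j : ℕ} {s' : State Var} {Q : ℕ → State Var → Prop},
      y ∉ X → AgreeOff X s' s → Flag .ans P s' → Flag y P' s →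
      (∀ t s'', t ≤ 5 * n + 6 → AgreeOff X s'' s →
        Flag .ans (P ∨ P' ∧ j + card s.mem n clB = s.reg .k) s'' → Q t s'') →
      Terminates M (whenEq y 1 (block [.set .x (.lit j), addCard clB,
        .ite (.eq (.reg .x) (.reg .k)) (.set .ans (.lit 1)) .skip])) s' Q := by
    intro P P' y j s' Q hy hA hP hP' hQ
    replace hP' := hP'.congr (hA.reg y hy) Iff.rfl
    simp only [whenEq, block]
    rw [terminates_ite, terminates_skip, terminates_seq, terminates_set, terminates_seq]
    simp only [Cond.Holds, Operand.val, hP'.eq_one_iff]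
    refine ⟨fun h => ?_, fun h => hQ _ _ (by omega) hA (hP.congr rfl (by simp [h]))⟩
    refine terminates_addCard _ (n := n) (by simp [hA.reg .n (by decide), hn])
      fun t1 s1 ht1 hA1 hx1 => ?_
    have hB1 := (hA1.mono (show _ ⊆ X by decide)).trans (hA.setReg (y := .x) (by decide) _)
    simp only [reg_setReg, mem_setReg, if_true, hA.mem] at hx1
    refine final hB1 (hP.congr ((hA1.reg .ans (by decide)).trans (by simp)) Iff.rfl) hx1
      fun s2 hA2 hF2 => hQ _ _ (by omega) hA2 (hF2.congr rfl ?_)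
    simp only [h, true_and]
    exact Iff.rfl
  have hP : Flag .ans False s := Or.inr ⟨hans, id⟩
  have first : ∀ {Q : ℕ → State Var → Prop},
      (∀ t s'', t ≤ 10 * n + 10 → AgreeOff X s'' s →
        Flag .ans (ComplA M s.mem n ∧ card s.mem n clA + card s.mem n clB = s.reg .k) s'' →
        Q t s'') →
      Terminates M (whenEq .compl 1 (block [.set .x (.lit 0), addCard clA, addCard clB,
        .ite (.eq (.reg .x) (.reg .k)) (.set .ans (.lit 1)) .skip])) s Q := by
    intro Q hQ
    simp only [whenEq, block]
    rw [terminates_ite, terminates_skip, terminates_seq, terminates_set, terminates_seq]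
    simp only [Cond.Holds, Operand.val, hF1.eq_one_iff]
    refine ⟨fun h => ?_, fun h =>
      hQ _ _ (by omega) (AgreeOff.refl _ _) (hP.congr rfl (by simp [h]))⟩
    refine terminates_addCard _ (n := n) (by simp [hn]) fun t1 s1 ht1 hA1 hx1 => ?_
    have hB1 := (hA1.mono (show _ ⊆ X by decide)).trans
      ((AgreeOff.refl _ _).setReg (y := Var.x) (by decide) _)
    simp only [reg_setReg, mem_setReg, if_true, zero_add] at hx1
    rw [terminates_seq]
    refine terminates_addCard _ (n := n) (by simp [hB1.reg .n (by decide), hn])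
      fun t2 s2 ht2 hA2 hx2 => ?_
    have hB2 := (hA2.mono (show _ ⊆ X by decide)).trans hB1
    rw [hx1, hB1.mem] at hx2
    refine final hB2 (hP.congr ((hA2.reg .ans (by decide)).trans
      ((hA1.reg .ans (by decide)).trans (by simp))) Iff.rfl) hx2
      fun s2 hA2 hF2 => hQ _ _ (by omega) hA2 (hF2.congr rfl ?_)
    simp only [h, true_and, false_or]
    exact Iff.rfl
  refine terminates_seq.2 (first fun t1 s1 ht1 hA1 hP1 => ?_)
  refine terminates_seq.2 (one (by decide) hA1 hP1 hF2 fun t2 s2 ht2 hA2 hP2 => ?_)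
  refine one (by decide) hA2 hP2 hF3 fun t3 s3 ht3 hA3 hP3 => ?_
  exact hQ _ _ (by omega) hA3 (hP3.congr rfl (by rw [or_assoc]; rfl))

/-- All questions of a round are answered by yes. -/
def RoundAccepts (M : ℕ → ℕ → ℕ) (m : ℕ → ℕ) (n : ℕ) : Prop :=
  (((((ComplA M m n ∨ IndepA M m n ∨ CycleA M m n) ∧ card m n clA ≠ 0) ∧
    ∀ u < n, ∀ v < n, NoPair M m clB clB 0 u v) ∧ ∀ u < n, ∀ v < n, NoPair M m clC clC 1 u v) ∧
    (∀ u < n, ∀ v < n, NoPair M m clA clB 0 u v)) ∧ (∀ u < n, ∀ v < n, NoPair M m clA clC 1 u v)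

/-- The memory `m` is the one written by `partition`, which no later part of the round changes; only
its first `n` cells are specified, and this determines the outcome. -/
theorem terminates_round (hn : s.reg .n = n) (hans : s.reg .ans = 0) (hgo : s.reg .go = 1)
    (hQ : ∀ t s' m, t ≤ 200 * (n * n + 1) → s'.reg .n = n →
      (∀ v < n, m v = classCode (1 + Nat.count (M v · = 1) n) (s.reg .k)) →
      (RoundAccepts M m n ∧ CheckVI M m n (s.reg .k) → s'.reg .ans = 1 ∧
        s'.reg .k = s.reg .k ∧ s'.reg .go = 0) →
      (¬ (RoundAccepts M m n ∧ CheckVI M m n (s.reg .k)) → s'.reg .ans = 0 ∧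
        (s.reg .k < n → s'.reg .k = s.reg .k + 1 ∧ s'.reg .go = 1) ∧
        (¬ s.reg .k < n → s'.reg .go = 0)) → Q t s') :
    Terminates M round s Q := by
  have hnn : n ≤ n * n := Nat.le_mul_self n
  simp only [round, block]
  rw [terminates_seq]
  refine terminates_partition hn fun t0 s0 ht0 hA0 hm0 => ?_
  rw [terminates_seq]
  refine terminates_questionI (n := n) (by rw [hA0 .n (by decide), hn])
    fun t1 s1 ht1 hA1 hc1 hi1 hy1 hF1 => ?_
  set X : List Var := [.u, .v, .cu, .cv, .e, .r, .ok] with hX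
  have hn1 : s1.reg .n = n := by rw [hA1.reg .n (by decide), hA0 .n (by decide), hn]
  have hk1 : s1.reg .k = s.reg .k := by rw [hA1.reg .k (by decide), hA0 .k (by decide)]
  have ha1 : s1.reg .ans = 0 := by rw [hA1.reg .ans (by decide), hA0 .ans (by decide), hans]
  have hg1 : s1.reg .go = 1 := by rw [hA1.reg .go (by decide), hA0 .go (by decide), hgo]
  rw [← hA1.mem] at hc1 hi1 hy1 hF1 hm0
  rw [terminates_seq]
  refine terminates_question _ _ _ hn1 hF1 fun t2 s2 ht2 hA2 hF2 => ?_
  rw [terminates_seq]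
  refine terminates_question _ _ _ ((hA2.reg .n (by decide)).trans hn1) hF2
    fun t3 s3 ht3 hA3 hF3 => ?_
  rw [hA2.mem] at hF3
  replace hA3 := hA3.trans hA2
  rw [terminates_seq]
  refine terminates_question _ _ _ ((hA3.reg .n (by decide)).trans hn1) hF3
    fun t4 s4 ht4 hA4 hF4 => ?_
  rw [hA3.mem] at hF4
  replace hA4 := hA4.trans hA3
  rw [terminates_seq]
  refine terminates_question _ _ _ ((hA4.reg .n (by decide)).trans hn1) hF4
    fun t5 s5 ht5 hA5 hF5 => ?_
  rw [hA4.mem] at hF5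
  replace hA5 := hA5.trans hA4
  replace hF5 : Flag .ok (RoundAccepts M s1.mem n) s5 := hF5
  replace hc1 := hc1.congr (hA5.reg .compl (by decide)) Iff.rfl
  replace hi1 := hi1.congr (hA5.reg .indep (by decide)) Iff.rfl
  replace hy1 := hy1.congr (hA5.reg .cyc (by decide)) Iff.rfl
  have hn5 := (hA5.reg .n (by decide)).trans hn1
  have hk5 := (hA5.reg .k (by decide)).trans hk1
  have ha5 := (hA5.reg .ans (by decide)).trans ha1
  have hg5 := (hA5.reg .go (by decide)).trans hg1
  rw [← hA5.mem] at hc1 hi1 hy1 hF5 hm0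
  have step : ∀ {Q : ℕ → State Var → Prop},
      (∀ t s', t ≤ 20 * n + 31 → s'.reg .n = n → s'.reg .k = s.reg .k → s'.reg .go = 1 →
        Flag .ans (RoundAccepts M s5.mem n ∧ CheckVI M s5.mem n (s.reg .k)) s' →
        Q t s') → Terminates M (whenEq .ok 1 stepVI) s5 Q := by
    intro Q hQ
    rw [whenEq, terminates_ite, terminates_skip]
    simp only [Cond.Holds, Operand.val, hF5.eq_one_iff]
    refine ⟨fun h => ?_, fun h => hQ _ _ (by omega) hn5 hk5 hg5 (Or.inr ⟨ha5, fun k => h k.1⟩)⟩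
    refine terminates_stepVI hn5 ha5 hc1 hi1 hy1 fun t s' ht hA hF => ?_
    rw [hk5] at hF
    exact hQ _ _ (by omega) ((hA.reg .n (by decide)).trans hn5) ((hA.reg .k (by decide)).trans hk5)
      ((hA.reg .go (by decide)).trans hg5) (hF.congr rfl (by simp [h]))
  rw [terminates_seq]
  refine step fun t6 s6 ht6 hn6 hk6 hg6 hF6 => ?_
  simp only [terminates_ite, terminates_set, terminates_inc, Cond.Holds, Operand.val,
    hF6.eq_one_iff, hn6, hk6]
  refine ⟨fun h => ?_, fun h => ⟨fun h' => ?_, fun h' => ?_⟩⟩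
  · refine hQ _ _ s5.mem (by omega) (by simp [hn6]) hm0 (fun _ => ?_) fun k => absurd h k
    simp [hF6.eq_one_iff.2 h, hk6]
  · refine hQ _ _ s5.mem (by omega) (by simp [hn6]) hm0 (fun k => absurd k h) fun _ => ?_
    simp [hF6.eq_zero_iff.2 h, h', hg6]
  · refine hQ _ _ s5.mem (by omega) (by simp [hn6]) hm0 (fun k => absurd k h) fun _ => ?_
    simp [hF6.eq_zero_iff.2 h, h']

/-- The program answers yes with the first number accepted in a round. -/
theorem terminates_program {P : ℕ → Prop} (hs : s.reg .n = n)
    (hP : ∀ k ≥ 1, ∀ m : ℕ → ℕ, (∀ v < n, m v = classCode (1 + Nat.count (M v · = 1) n) k) →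
      (RoundAccepts M m n ∧ CheckVI M m n k ↔ P k)) :
    Terminates M program s fun t s' => t ≤ 1000 * (n ^ 3 + 1) ∧
      (s'.reg .ans = 1 ∧ P (s'.reg .k) ∨ s'.reg .ans = 0 ∧ ∀ k, 1 ≤ k → k ≤ n → ¬ P k) := by
  set T := 200 * (n * n + 1) with hT
  -- Here `j` counts the increments of `k` still possible. The maximum covers `n = 0`, where the
  -- round for `k = 1` is executed nevertheless.
  have loop : ∀ j k, 1 ≤ k → k + j = max n 1 → (∀ k', 1 ≤ k' → k' < k → ¬ P k') →
      ∀ s : State Var, s.reg .n = n → s.reg .k = k → s.reg .ans = 0 → s.reg .go = 1 →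
      Terminates M (.loop (.eq (.reg .go) (.lit 1)) round) s fun t s' =>
        t ≤ (j + 1) * (T + 1) + 1 ∧
        (s'.reg .ans = 1 ∧ P (s'.reg .k) ∨ s'.reg .ans = 0 ∧ ∀ k, 1 ≤ k → k ≤ n → ¬ P k) := by
    intro j
    induction j with
    | zero =>
      intro k hk hkj hmin s hn hk' ha hg
      rw [terminates_loop]
      simp only [Cond.Holds, Operand.val, hg, not_true_eq_false, IsEmpty.forall_iff, and_true,
        forall_const]
      refine terminates_round hn ha hg fun t s' m ht hn' hm h1 h2 => ?_
      rw [hk'] at hm h1 h2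
      rw [hP k hk m hm] at h1 h2
      have hgo : s'.reg .go = 0 := by
        by_cases h : P k
        · exact (h1 h).2.2
        · exact (h2 h).2.2 (by omega)
      rw [terminates_loop]
      simp only [Cond.Holds, Operand.val, hgo, zero_ne_one, not_false_eq_true, IsEmpty.forall_iff,
        true_and, forall_const]
      refine ⟨by omega, ?_⟩
      by_cases h : P k
      · exact Or.inl ⟨(h1 h).1, by rw [(h1 h).2.1]; exact h⟩
      · refine Or.inr ⟨(h2 h).1, fun k' hk1 hk2 => ?_⟩
        rcases (show k' ≤ k by omega).lt_or_eq with h' | rfl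
        · exact hmin k' hk1 h'
        · exact h
    | succ j ih =>
      intro k hk hkj hmin s hn hk' ha hg
      rw [terminates_loop]
      simp only [Cond.Holds, Operand.val, hg, not_true_eq_false, IsEmpty.forall_iff, and_true,
        forall_const]
      refine terminates_round hn ha hg fun t s' m ht hn' hm h1 h2 => ?_
      rw [hk'] at hm h1 h2
      rw [hP k hk m hm] at h1 h2
      have hmul : (j + 1 + 1) * (T + 1) = (j + 1) * (T + 1) + (T + 1) := by ring
      by_cases h : P k
      · rw [terminates_loop]
        simp only [Cond.Holds, Operand.val, (h1 h).2.2, zero_ne_one, not_false_eq_true,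
          IsEmpty.forall_iff, true_and, forall_const]
        exact ⟨by omega, Or.inl ⟨(h1 h).1, by rw [(h1 h).2.1]; exact h⟩⟩
      · obtain ⟨h3, h4, -⟩ := h2 h
        obtain ⟨h4, h5⟩ := h4 (by omega)
        refine (ih (k + 1) (by omega) (by omega) (fun k' hk1 hk2 => ?_) s' hn' h4 h3 h5).mono ?_
        · rcases (show k' ≤ k by omega).lt_or_eq with h' | rfl
          · exact hmin k' hk1 h'
          · exact h
        · rintro t' s'' ⟨ht', h'⟩
          exact ⟨by omega, h'⟩
  simp only [program, block, terminates_seq, terminates_set, Operand.val]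
  refine (loop (max n 1 - 1) 1 le_rfl (by omega) (fun k' h1 h2 => by omega) _ (by simp [hs])
    (by simp) (by simp) (by simp)).mono ?_
  rintro t s' ⟨ht, h⟩
  refine ⟨?_, h⟩
  rw [Nat.sub_add_cancel (le_max_right _ _)] at ht
  rcases Nat.eq_zero_or_pos n with rfl | hn
  · simp [hT] at ht ⊢
    omega
  · rw [max_eq_left hn] at ht
    have e : n * (T + 1) = 200 * n ^ 3 + 201 * n := by rw [hT]; ring
    have : n ≤ n ^ 3 := Nat.le_self_pow (by norm_num) n
    omega

end AlgorithmNG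

/-! ### The outcome of a round is the outcome of the degree conditions -/

namespace AlgorithmNG

open Finset SimpleGraph

theorem count_eq_card_filter_fin (p : ℕ → Prop) [DecidablePred p] (n : ℕ) :
    Nat.count p n = #{i : Fin n | p i} := by
  rw [Nat.count_eq_card_filter_range, card_filter, card_filter,
    Fin.sum_univ_eq_sum_range (fun i => if p i then 1 else 0)]

variable {n : ℕ} (G : SimpleGraph (Fin n)) [DecidableRel G.Adj]

theorem inputMatrix_eq_one_iff (u v : Fin n) : inputMatrix G u v = 1 ↔ G.Adj u v := by
  simp [inputMatrix]

theorem inputMatrix_eq_zero_iff (u v : Fin n) : inputMatrix G u v = 0 ↔ ¬ G.Adj u v := by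
  simp [inputMatrix]

theorem count_inputMatrix (v : Fin n) : Nat.count (inputMatrix G v · = 1) n = G.degree v := by
  rw [count_eq_card_filter_fin, ← card_neighborFinset_eq_degree]
  congr 1
  ext u
  simp [inputMatrix_eq_one_iff]

theorem forall_noPair_iff {M : ℕ → ℕ → ℕ} {m : ℕ → ℕ} {c c' bad : ℕ} :
    (∀ u < n, ∀ v < n, NoPair M m c c' bad u v) ↔
      ∀ u v : Fin n, m u = c → m v = c' → u ≠ v → M u v ≠ bad := by
  simp only [Fin.forall_iff, NoPair, ne_eq, Fin.mk.injEq]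

theorem roundAccepts_and_checkVI_iff {m : ℕ → ℕ} {k : ℕ} (hm : ∀ v < n,
    m v = classCode (1 + Nat.count (inputMatrix G v · = 1) n) k) :
    RoundAccepts (inputMatrix G) m n ∧ CheckVI (inputMatrix G) m n k ↔ ABCConditions G k := by
  have hA : ∀ v : Fin n, m v = clA ↔ v ∈ classA G k := by
    intro v
    rw [hm v v.2, count_inputMatrix, classCode, classA, Set.mem_ofPred_eq, add_comm]
    split_ifs <;> simp [*]
  have hB : ∀ v : Fin n, m v = clB ↔ v ∈ classB G k := by
    intro v
    rw [hm v v.2, count_inputMatrix, classCode, classB, Set.mem_ofPred_eq, add_comm]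
    split_ifs <;> simp [*]
  have hC : ∀ v : Fin n, m v = clC ↔ v ∈ classC G k := by
    intro v
    rw [hm v v.2, count_inputMatrix, classCode, classC, Set.mem_ofPred_eq, add_comm]
    split_ifs <;> simp <;> omega
  have cA : card m n clA = (classA G k).ncard := by
    rw [card, count_eq_card_filter_fin, ← Set.ncard_coe_finset]
    congr 1; ext v; simp [← hA]
  have cB : card m n clB = (classB G k).ncard := by
    rw [card, count_eq_card_filter_fin, ← Set.ncard_coe_finset]
    congr 1; ext v; simp [← hB]
  have hne : card m n clA ≠ 0 ↔ (classA G k).Nonempty := by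
    rw [cA, ← Set.ncard_pos, Nat.pos_iff_ne_zero]
  have hcl : ComplA (inputMatrix G) m n ↔ G.IsClique (classA G k) := by
    simp only [ComplA, forall_noPair_iff, hA, ne_eq, inputMatrix_eq_zero_iff, not_not]
    exact ⟨fun h u hu v hv => h u v hu hv, fun h u v hu hv => h hu hv⟩
  have hin : IndepA (inputMatrix G) m n ↔ G.IsIndepSet (classA G k) := by
    simp only [IndepA, forall_noPair_iff, hA, ne_eq, inputMatrix_eq_one_iff]
    exact ⟨fun h u hu v hv => h u v hu hv, fun h u v hu hv => h hu hv⟩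
  have hcy : CycleA (inputMatrix G) m n ↔
      Nonempty (G.induce (classA G k) ≃g cycleGraph 5) := by
    rw [nonempty_induce_iso_cycleGraph_five_iff (S := {v : Fin n | m v = clA}) (by simp [hA]),
      CycleA, card, count_eq_card_filter_fin]
    simp only [degreeA, count_eq_card_filter_fin, mem_filter, mem_univ, true_and, Fin.forall_iff,
      filter_filter]
    refine and_congr_right fun _ => forall₂_congr fun u hu => ?_
    simp only [← inputMatrix_eq_one_iff]
  have hBB : (∀ u < n, ∀ v < n, NoPair (inputMatrix G) m clB clB 0 u v) ↔
      G.IsClique (classB G k) := by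
    simp only [forall_noPair_iff, hB, ne_eq, inputMatrix_eq_zero_iff, not_not]
    exact ⟨fun h u hu v hv => h u v hu hv, fun h u v hu hv => h hu hv⟩
  have hCC : (∀ u < n, ∀ v < n, NoPair (inputMatrix G) m clC clC 1 u v) ↔
      G.IsIndepSet (classC G k) := by
    simp only [forall_noPair_iff, hC, ne_eq, inputMatrix_eq_one_iff]
    exact ⟨fun h u hu v hv => h u v hu hv, fun h u v hu hv => h hu hv⟩
  have hAB : (∀ u < n, ∀ v < n, NoPair (inputMatrix G) m clA clB 0 u v) ↔
      ∀ a ∈ classA G k, ∀ b ∈ classB G k, G.Adj a b := by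
    simp only [forall_noPair_iff, hA, hB, ne_eq, inputMatrix_eq_zero_iff, not_not]
    -- The test skips the diagonal, harmlessly here because `A` and `B` are disjoint.
    refine ⟨fun h u hu v hv => h u v hu hv ?_, fun h u v hu hv _ => h u hu v hv⟩
    rintro rfl
    simp only [classA, classB, Set.mem_ofPred_eq] at hu hv
    omega
  have hAC : (∀ u < n, ∀ v < n, NoPair (inputMatrix G) m clA clC 1 u v) ↔
      ∀ a ∈ classA G k, ∀ c ∈ classC G k, ¬ G.Adj a c := by
    simp only [forall_noPair_iff, hA, hC, ne_eq, inputMatrix_eq_one_iff]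
    exact ⟨fun h u hu v hv huv => h u v hu hv huv.ne huv, fun h u v hu hv _ => h u hu v hv⟩
  rw [RoundAccepts, CheckVI, hne, hcl, hin, hcy, hBB, hCC, hAB, hAC, cA, cB, add_comm 1, add_comm 3]
  constructor
  -- The disjunction on the form of `G[A]` is implied by check (vi), so it can be dropped here and
  -- recovered from `form` in the converse.
  · rintro ⟨⟨⟨⟨⟨⟨-, h1⟩, h2⟩, h3⟩, h4⟩, h5⟩, h6⟩
    exact ⟨h1, h6, h2, h3, h4, h5⟩
  · rintro ⟨h1, h2, h3, h4, h5, h6⟩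
    exact ⟨⟨⟨⟨⟨⟨h2.imp And.left (Or.imp And.left And.left), h1⟩, h3⟩, h4⟩, h5⟩, h6⟩, h2⟩

end AlgorithmNG

/-- Algorithm NG, run on the adjacency matrix of any graph `G` with `n` vertices, halts after
`O(n ^ 3)` steps; it answers yes exactly if `G` is an NG-graph (and no otherwise), and then `k`
is the chromatic number.  Its answer is the outcome of the degree conditions: a candidate `k`
satisfies them exactly if the answer is yes with this `k`. -/
theorem mainTheorem5 :
    ∃ c : ℕ, ∀ (n : ℕ) (G : SimpleGraph (Fin n)) [DecidableRel G.Adj],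
      ∃ (t : ℕ) (s : RAM.State AlgorithmNG.Var),
        RAM.Exec (AlgorithmNG.inputMatrix G) AlgorithmNG.program (AlgorithmNG.initState n) t s ∧
        t ≤ c * (n ^ 3 + 1) ∧
        (IsNGGraph G → s.reg .ans = 1 ∧ G.chromaticNumber = (s.reg .k : ℕ∞)) ∧
        (¬ IsNGGraph G → s.reg .ans = 0) ∧
        ∀ k : ℕ, 1 ≤ k → k ≤ n →
          (ABCConditions G k ↔ s.reg .ans = 1 ∧ s.reg .k = k) := by
  refine ⟨1000, fun n G _ => ?_⟩
  obtain ⟨t, s, hexec, ht, h⟩ := AlgorithmNG.terminates_program (M := AlgorithmNG.inputMatrix G)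
    (s := AlgorithmNG.initState n) (n := n) (P := ABCConditions G) rfl
    fun k _ m hm => AlgorithmNG.roundAccepts_and_checkVI_iff G hm
  refine ⟨t, s, hexec, ht, ?_⟩
  rcases h with ⟨ha, hk⟩ | ⟨ha, hk⟩
  · refine ⟨fun _ => ⟨ha, hk.chromaticNumber_eq⟩,
      fun h => absurd (isNGGraph_iff_exists_abcConditions.2 ⟨_, hk⟩) h,
      fun k _ _ => ⟨fun h => ⟨ha, ?_⟩, ?_⟩⟩
    -- Two accepted candidates both equal `χ(G)`, hence coincide.
    · exact_mod_cast hk.chromaticNumber_eq.symm.trans h.chromaticNumber_eq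
    · rintro ⟨-, rfl⟩
      exact hk
  -- The conditions force `1 ≤ k ≤ n`, so the finite search has missed nothing.
  · have hk' : ∀ k, ¬ ABCConditions G k := fun k h =>
      hk k h.one_le (by simpa using h.le_card) h
    refine ⟨fun h => ?_, fun _ => ha, fun k _ _ => ?_⟩
    · obtain ⟨k, h⟩ := isNGGraph_iff_exists_abcConditions.1 h
      exact absurd h (hk' k)
    · simp [hk' k, ha]
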